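/- **Setting.** Let $D$ be an infinite set of domain values and $X$ a set of variables. A relational schema is a finite list of relations $R$, each with a nonempty finite set of attributes. Fix, for each relation $R$, a number of tuple identifiers $d$; the *fields* are the names $R.d.A$, with $d$ an identifier for $R$ and $A$ an attribute of $R$. A *gWSD* is a pair $\mathcal W=(\{C_1,\dots,C_m\},\phi)$ where * the *components* $C_1,\dots,C_m$ are finite, possibly empty tables with values in $D\cup X\cup\{\bot\}$, whose schemas are nonempty sets of fields that partition the set of all fields; the tuples of $C_i$ are called its *local worlds*; * the *global condition* $\phi$ is a finite conjunction of negated equalities $a\neq b$ with $a,b\in D\cup X$. Choosing one tuple of each component and concatenating them gives a tuple $w\in C_1\times\cdots\times C_m$, which encodes the tables in which $R$ has the tuple $(w(R.d.A))_A$ for each identifier $d$ for which none of these values is $\bot$. The set $\mathit{rep}(\mathcal W)$ of possible worlds consists of the databases obtained from these tables by a valuation $\nu:X\to D$ that makes $\phi$ true, over all choices of $w$ and all such $\nu$. The gWSD is *tuple-level* if for every $R$ and $d$ all the fields $R.d.A$ belong to the same component. A tuple $t\in D^{ar(R)}$ is *certain* in $R$ if $t\in R^{\mathcal A}$ for all $\mathcal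 A\in\mathit{rep}(\mathcal W)$. **Theorem.** 1. Tuple certainty is decidable in polynomial time for tuple-level gWSDs: for every countable infinite domain $D$ and countable set $X$ of variables, with domain values and variables written as bit strings by fixed injective encodings, there is a Turing machine that, given a relational schema, a tuple-level gWSD over it, a relation $R$ of the schema and a tuple $t\in D^{ar(R)}$ (numbers being written in binary), decides in time polynomial in the length of the input whether $t$ is certain in $R$. 2. For every infinite $D$, every $X$, every tuple-level gWSD $(\{C_1,\dots,C_m\},\phi)$ and every tuple $t\in D^{ar(R)}$ of a relation $R$ of its schema: $t$ is certain in $R$ if and only if $\phi$ is unsatisfiable or there is a component $C_i$ such that every local world of $C_i$ contains $t$ itself, without variables, that is, it has the constant values of $t$ in all the fields $R.d.A$ for some identifier $d$ (which may depend on the local world). -/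

import Mathlib

namespace WorldSet

universe u v

/-- A relational schema `(R₁[U₁], …, R_k[U_k])`: finitely many relations, each with a nonempty finite
set of attributes. Relation names and attribute names are numbered. -/
structure Schema where
  k : ℕ
  ar : Fin k → ℕ
  ar_pos : ∀ r, 0 < ar r

/-- A relational structure over `S` with domain `D`. -/
abbrev Database (S : Schema) (D : Type u) : Type u :=
  (r : Fin S.k) → Set (Fin (S.ar r) → D)

/-- Elements of `D ∪ X`: domain values and variables. -/
inductive Symb (D : Type u) (X : Type v) : Type (max u v)
  | const (c : D)
  | var (x : X)

/-- Elements of `D ∪ X ∪ {⊥}`: the values in the components of a world-set decomposition. -/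
inductive Val (D : Type u) (X : Type v) : Type (max u v)
  | sym (s : Symb D X)
  | bot

/-- A valuation `ν : X → D`, extended to be the identity on domain values. -/
def Symb.eval {D : Type u} {X : Type v} (ν : X → D) : Symb D X → D
  | .const c => c
  | .var x => ν x

/-- A global condition: the conjunction of the negated equalities `a ≠ b`, for `(a, b)` in the list
(the empty list is "true"). -/
abbrev Condition (D : Type u) (X : Type v) : Type (max u v) := List (Symb D X × Symb D X)

/-- The valuation `ν` makes the condition true. -/
def Condition.Holds {D : Type u} {X : Type v} (φ : Condition D X) (ν : X → D) : Prop :=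
  ∀ p ∈ φ, p.1.eval ν ≠ p.2.eval ν

/-- Some valuation makes the condition true. -/
def Condition.Satisfiable {D : Type u} {X : Type v} (φ : Condition D X) : Prop :=
  ∃ ν : X → D, φ.Holds ν

/-- A g-multitable: one table over `D ∪ X` for each relation, and a global condition. -/
structure GMultitable (S : Schema) (D : Type u) (X : Type v) where
  table : (r : Fin S.k) → Set (Fin (S.ar r) → Symb D X)
  cond : Condition D X

/-- The database `ν(T)`. -/
def GMultitable.world {S : Schema} {D : Type u} {X : Type v} (T : GMultitable S D X) (ν : X → D) :
    Database S D :=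
  fun r => {t | ∃ s ∈ T.table r, t = fun a => (s a).eval ν}

/-- The world-set represented by a g-multitable: the databases `ν(T)` for the satisfactions `ν`. -/
def GMultitable.rep {S : Schema} {D : Type u} {X : Type v} (T : GMultitable S D X) :
    Set (Database S D) :=
  {A | ∃ ν : X → D, T.cond.Holds ν ∧ A = T.world ν}

/-- The fields `R.d.A` of an inlined table in which the relation `R` has `n R` tuple identifiers. -/
@[ext]
structure TField (S : Schema) (n : Fin S.k → ℕ) where
  rel : Fin S.k
  tid : Fin (n rel)
  attr : Fin (S.ar rel)

/-- A g-tabset table `(W, φ)`: a table over the fields `R.d.A` with values in `D ∪ X ∪ {⊥}`,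
and a single global condition shared by all its tuples. -/
structure GTST (S : Schema) (D : Type u) (X : Type v) where
  n : Fin S.k → ℕ
  table : Set (TField S n → Val D X)
  cond : Condition D X

/-- The inverse of inlining: `R` consists of the tuples at the identifiers `d` of `R` that have no
occurrence of `⊥`. -/
def inlineInv {S : Schema} {n : Fin S.k → ℕ} {D : Type u} {X : Type v}
    (w : TField S n → Val D X) (φ : Condition D X) : GMultitable S D X where
  table r := {s | ∃ d : Fin (n r), ∀ a, w ⟨r, d, a⟩ = .sym (s a)}
  cond := φ

/-- The world-set represented by a g-tabset table. -/
def GTST.rep {S : Schema} {D : Type u} {X : Type v} (T : GTST S D X) : Set (Database S D) :=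
  ⋃ w ∈ T.table, (inlineInv w T.cond).rep

/-- An attribute-level gWSD `({C₁, …, C_m}, φ)`. The schemas of the components partition the set of
all fields: the component of the field `f` is `comp f`, and no component is nullary. The component
`C_j` is the set of the tuples in the list `rows j`; these tuples are its local worlds. -/
structure GWSD (S : Schema) (D : Type u) (X : Type v) where
  n : Fin S.k → ℕ
  m : ℕ
  comp : TField S n → Fin m
  comp_surjective : Function.Surjective comp
  rows : (j : Fin m) → List ({f : TField S n // comp f = j} → Val D X)
  cond : Condition D X

namespace GWSD

variable {S : Schema} {D : Type u} {X : Type v}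

/-- The g-tabset table `(C₁ × ⋯ × C_m, φ)`. -/
def toGTST (W : GWSD S D X) : GTST S D X where
  n := W.n
  table := {w | ∀ j, (fun f : {f : TField S W.n // W.comp f = j} => w f.1) ∈ W.rows j}
  cond := W.cond

/-- The world-set represented by a gWSD. -/
def rep (W : GWSD S D X) : Set (Database S D) := W.toGTST.rep

/-- All fields of the same tuple `R.d` are in the same component. -/
def TupleLevel (W : GWSD S D X) : Prop :=
  ∀ (r : Fin S.k) (d : Fin (W.n r)) (a b : Fin (S.ar r)),
    W.comp ⟨r, d, a⟩ = W.comp ⟨r, d, b⟩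

/-- The tuple `t` is in the relation `r` of every possible world. -/
def Certain (W : GWSD S D X) (r : Fin S.k) (t : Fin (S.ar r) → D) : Prop :=
  ∀ A ∈ W.rep, t ∈ A r

/-- The local world `w` of the component `j` contains the tuple `t` of the relation `r`, itself and
not just an instantiation: for some identifier `d`, the component `j` has all the fields `r.d.A`, and
`w` has there the constants of `t`. -/
def RowContains (W : GWSD S D X) (j : Fin W.m) (w : {f : TField S W.n // W.comp f = j} → Val D X)
    (r : Fin S.k) (t : Fin (S.ar r) → D) : Prop :=
  ∃ d : Fin (W.n r), ∀ a, ∃ h : W.comp ⟨r, d, a⟩ = j, w ⟨⟨r, d, a⟩, h⟩ = .sym (.const (t a))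

end GWSD

/-- An instance of the tuple certainty problem for tuple-level gWSDs: a schema, a tuple-level gWSD
over it, and a tuple of one of the relations. -/
structure CertInstance (D : Type u) (X : Type v) where
  schema : Schema
  wsd : GWSD schema D X
  tupleLevel : wsd.TupleLevel
  rel : Fin schema.k
  tup : Fin (schema.ar rel) → D

/-- The question of the tuple certainty problem. -/
def CertInstance.Certain {D : Type u} {X : Type v} (I : CertInstance D X) : Prop :=
  I.wsd.Certain I.rel I.tup

/-! Instances are written as words over the finite alphabet `Letter`. Numbers are in binary. Domain
values and variables are written as given bit strings. -/

/-- The input alphabet. -/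
inductive Letter : Type
  | bit (b : Bool)
  | arity
  | query
  | const
  | var
  | bot
  | neq
  | component
  | row
  | field
  | dot

section Encoding

variable {D : Type u} {X : Type v} (encD : D → List Bool) (encX : X → List Bool)

/-- A bit string as a word. -/
def bitsWord (l : List Bool) : List Letter := l.map Letter.bit

/-- A natural number, in binary. -/
def natWord (n : ℕ) : List Letter := bitsWord (Computability.encodeNat n)

/-- A domain value or a variable, with a mark that tells which. -/
def symbWord : Symb D X → List Letter
  | .const c => Letter.const :: bitsWord (encD c)
  | .var x => Letter.var :: bitsWord (encX x)

/-- A domain value, a variable or `⊥`. -/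
def valWord : Val D X → List Letter
  | .sym s => symbWord encD encX s
  | .bot => [Letter.bot]

/-- A field name `R.d.A`. -/
def fieldWord {S : Schema} {n : Fin S.k → ℕ} (f : TField S n) : List Letter :=
  Letter.field :: natWord f.rel ++ Letter.dot :: natWord f.tid ++ Letter.dot :: natWord f.attr

/-- All fields, in lexicographic order. -/
def allFields (S : Schema) (n : Fin S.k → ℕ) : List (TField S n) :=
  (List.finRange S.k).flatMap fun r =>
    (List.finRange (n r)).flatMap fun d =>
      (List.finRange (S.ar r)).map fun a => ⟨r, d, a⟩

/-- The fields of the component `j`, in lexicographic order. -/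
def GWSD.columns {S : Schema} (W : GWSD S D X) (j : Fin W.m) :
    List {f : TField S W.n // W.comp f = j} :=
  (allFields S W.n).filterMap fun f => if h : W.comp f = j then some ⟨f, h⟩ else none

/-- The schema: the list of the arities of its relations. -/
def schemaWord (S : Schema) : List Letter :=
  (List.finRange S.k).flatMap fun r => Letter.arity :: natWord (S.ar r)

/-- A relation name and a tuple for it. -/
def queryWord {S : Schema} (r : Fin S.k) (t : Fin (S.ar r) → D) : List Letter :=
  Letter.query :: natWord r ++
    (List.finRange (S.ar r)).flatMap fun a => Letter.const :: bitsWord (encD (t a))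

/-- A global condition: the list of its negated equalities. -/
def condWord (φ : Condition D X) : List Letter :=
  φ.flatMap fun p => Letter.neq :: symbWord encD encX p.1 ++ symbWord encD encX p.2

/-- A component: its schema, followed by its tuples, each as a list of pairs of a field and a value. -/
def componentWord {S : Schema} (W : GWSD S D X) (j : Fin W.m) : List Letter :=
  Letter.component :: (W.columns j).flatMap (fun f => fieldWord f.1) ++
    (W.rows j).flatMap fun w =>
      Letter.row :: (W.columns j).flatMap fun f => fieldWord f.1 ++ valWord encD encX (w f)

/-- An instance of the tuple certainty problem. -/
def instanceWord (I : CertInstance D X) : List Letter :=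
  schemaWord I.schema ++ queryWord encD I.rel I.tup ++ condWord encD encX I.wsd.cond ++
    (List.finRange I.wsd.m).flatMap fun j => componentWord encD encX I.wsd j

end Encoding

/-- The predicate `P` is decided in polynomial time by a Turing machine that reads the word `enc a`. -/
def DecidableInPolyTime {α Γ : Type} (enc : α → List Γ) (P : α → Prop) : Prop :=
  ∃ f : α → Bool, (∀ a, f a = true ↔ P a) ∧
    Nonempty (Turing.TM2ComputableInPolyTime enc Computability.encodeBool f)

end WorldSet

namespace WorldSet

universe u v

/-! ### The characterization of certain tuples. -/

section Certainty

variable {D : Type u} {X : Type v}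

/-! A component all of whose local worlds contain the tuple supplies it in every world. For the
converse, suppose the condition is satisfiable and each component has a local world missing the
tuple. Combine these local worlds and evaluate by a valuation that is injective on the finitely many
symbols in play: variables go to distinct fresh domain values (`exists_injOn_eval`). No conjunct of
a satisfiable condition has two identical sides, so this valuation satisfies it (compare
`Condition.satisfiable_iff`). If the resulting world contained the tuple, injectivity would force
its constants to stand literally at some identifier; being tuple-level, the gWSD has that identifier
in one component, against the choice of local world. This is `GWSD.certain_iff`.

The criterion is purely syntactic: find a conjunct with identical sides, or a component with the
tuple in every row. As the encodings are injective and values are delimited by marks, it only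
requires comparing words. Fields are listed lexicographically and components are tuple-level, so in
each row the values of one identifier form a contiguous block in attribute order. One left-to-right
pass therefore suffices, with a finite control and three rewindable buffers: the queried relation
name, the queried tuple, and the first side of the current conjunct.

Such an automaton is simulated by a stack machine with two stacks per buffer. A letter costs at most
linear time, for rewinding or clearing, so the whole run is quadratic
(`Streamer.decidableInPolyTime`). Correctness on encoded instances is `verdict_instanceWord`,
obtained from the invariants `CondReady`, `CompReady`, `RowReady` and `RowState`. -/

theorem exists_injOn_eval [Infinite D] {L : Set (Symb D X)} (hL : L.Finite) :
    ∃ ν : X → D, Set.InjOn (Symb.eval ν) L := by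
  classical
  have hF : {x | Symb.var x ∈ L}.Finite :=
    hL.preimage (Function.Injective.injOn fun _ _ h => by injection h)
  have hG : {c | Symb.const c ∈ L}.Finite :=
    hL.preimage (Function.Injective.injOn fun _ _ h => by injection h)
  have : Countable {x | Symb.var x ∈ L} := hF.countable
  have : Infinite ↥{c | Symb.const c ∈ L}ᶜ := hG.infinite_compl.to_subtype
  obtain ⟨e, he⟩ := exists_injective_nat {x | Symb.var x ∈ L}
  let g := Infinite.natEmbedding ↥{c | Symb.const c ∈ L}ᶜ
  -- Variables in `L` get distinct values that are not constants of `L`; the value of the others is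
  -- irrelevant.
  let ν : X → D := fun x =>
    if h : Symb.var x ∈ L then (g (e ⟨x, h⟩)).1 else Classical.arbitrary D
  have hν : ∀ x (h : Symb.var x ∈ L), ν x = (g (e ⟨x, h⟩)).1 := fun x h => dif_pos h
  have hfresh : ∀ x, Symb.var x ∈ L → Symb.const (ν x) ∉ L := fun x h => by
    rw [hν x h]; exact (g (e ⟨x, h⟩)).2
  refine ⟨ν, ?_⟩
  rintro (c | x) hs (c' | x') hs' h
  · exact congrArg _ h
  · exact absurd ((show c = ν x' from h) ▸ hs) (hfresh x' hs')
  · exact absurd ((show ν x = c' from h) ▸ hs') (hfresh x hs)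
  · have h : ν x = ν x' := h
    rw [hν x hs, hν x' hs'] at h
    have := he (g.injective (Subtype.ext h))
    rw [Subtype.mk.injEq] at this
    rw [this]

/-- A valuation injective on the symbols of the condition separates any two that differ
syntactically. -/
theorem Condition.satisfiable_iff [Infinite D] (φ : Condition D X) :
    φ.Satisfiable ↔ ∀ p ∈ φ, p.1 ≠ p.2 := by
  refine ⟨fun ⟨ν, h⟩ p hp e => h p hp (by rw [e]), fun h => ?_⟩
  have hL : {s | ∃ p ∈ φ, s = p.1 ∨ s = p.2}.Finite := by
    have : {s | ∃ p ∈ φ, s = p.1 ∨ s = p.2} = ⋃ p ∈ {p | p ∈ φ}, {p.1, p.2} := by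
      ext s; simp
    rw [this]
    exact (List.finite_toSet φ).biUnion fun p _ => Set.toFinite _
  obtain ⟨ν, hν⟩ := exists_injOn_eval hL
  exact ⟨ν, fun p hp e => h p hp (hν ⟨p, hp, .inl rfl⟩ ⟨p, hp, .inr rfl⟩ e)⟩

instance (S : Schema) (n : Fin S.k → ℕ) : Finite (TField S n) :=
  Finite.of_injective
    (fun f : TField S n => (⟨f.rel, f.tid, f.attr⟩ : Σ r, Fin (n r) × Fin (S.ar r))) <| by
    rintro ⟨r, d, a⟩ ⟨r', d', a'⟩ h
    simp only [Sigma.mk.injEq] at h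
    obtain ⟨rfl, h⟩ := h
    simpa using h

theorem GWSD.certain_iff [Infinite D] {S : Schema} (W : GWSD S D X) (hW : W.TupleLevel)
    (r : Fin S.k) (t : Fin (S.ar r) → D) :
    W.Certain r t ↔
      (¬ W.cond.Satisfiable ∨ ∃ j : Fin W.m, ∀ w ∈ W.rows j, W.RowContains j w r t) := by
  constructor
  · intro hc
    by_contra! hn
    obtain ⟨hsat, hrow⟩ := hn
    choose row hmem hrow using hrow
    -- The counterexample world: in each component, a local world without the tuple.
    let w : TField S W.n → Val D X := fun f => row (W.comp f) ⟨f, rfl⟩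
    have hw : ∀ j, (fun f : {f // W.comp f = j} => w f.1) = row j := by
      intro j
      ext ⟨f, hf⟩
      subst hf
      rfl
    have hL : ({s | ∃ p ∈ W.cond, s = p.1 ∨ s = p.2} ∪ {s | ∃ f, w f = .sym s} ∪
        Set.range fun a => Symb.const (t a)).Finite := by
      have h1 : {s | ∃ p ∈ W.cond, s = p.1 ∨ s = p.2} =
          ⋃ p ∈ {p | p ∈ W.cond}, {p.1, p.2} := by
        ext s; simp
      have h2 : {s | ∃ f, w f = .sym s}.Finite :=
        (Set.finite_range w).preimage (f := Val.sym)
          (Function.Injective.injOn fun _ _ h => by injection h)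
      refine Set.Finite.union (Set.Finite.union ?_ h2) (Set.finite_range _)
      rw [h1]
      exact (List.finite_toSet W.cond).biUnion fun p _ => Set.toFinite _
    obtain ⟨ν, hν⟩ := exists_injOn_eval hL
    have hholds : W.cond.Holds ν := fun p hp e =>
      (Condition.satisfiable_iff W.cond).1 hsat p hp
        (hν (.inl (.inl ⟨p, hp, .inl rfl⟩)) (.inl (.inl ⟨p, hp, .inr rfl⟩)) e)
    have hrep : (inlineInv w W.cond).world ν ∈ W.rep := by
      refine Set.mem_biUnion (show w ∈ W.toGTST.table from fun j => ?_) ⟨ν, hholds, rfl⟩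
      rw [hw]; exact hmem j
    obtain ⟨s, ⟨d, hd⟩, hs⟩ := hc _ hrep
    -- Injectivity on a set containing also the constants of `t` turns equality of values into
    -- equality of symbols.
    have hs' : ∀ a, s a = .const (t a) := fun a =>
      hν (.inl (.inr ⟨_, hd a⟩)) (.inr ⟨a, rfl⟩) (congrFun hs a).symm
    -- Positive arity provides a field to name the component; tuple-levelness puts the other fields
    -- there too.
    refine hrow (W.comp ⟨r, d, ⟨0, S.ar_pos r⟩⟩) ⟨d, fun a => ⟨hW r d _ _, ?_⟩⟩
    rw [← hw]
    exact (hd a).trans (by rw [hs'])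
  · rintro (hu | ⟨j, hj⟩) A hA
    · obtain ⟨w, -, ν, hν, -⟩ := Set.mem_iUnion₂.1 hA
      exact absurd ⟨ν, hν⟩ hu
    · obtain ⟨w, hw, ν, -, rfl⟩ := Set.mem_iUnion₂.1 hA
      obtain ⟨d, hd⟩ := hj _ (hw j)
      exact ⟨fun a => .const (t a), ⟨d, fun a => (hd a).2⟩, rfl⟩

end Certainty

/-! ### Reachability with a bound on the number of steps. -/

open Turing StateTransition

/-- `c'` is reached from `c` in at most `n` steps. -/
def ReachesWithin {σ : Type*} (f : σ → Option σ) (n : ℕ) (c c' : σ) : Prop :=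
  ∃ k ≤ n, (flip bind f)^[k] (some c) = some c'

namespace ReachesWithin

variable {σ : Type*} {f : σ → Option σ} {c c' c'' : σ} {m n : ℕ}

theorem refl (n : ℕ) (c : σ) : ReachesWithin f n c c := ⟨0, n.zero_le, rfl⟩

theorem trans (h : ReachesWithin f m c c') (h' : ReachesWithin f n c' c'') :
    ReachesWithin f (m + n) c c'' := by
  obtain ⟨k, hk, e⟩ := h
  obtain ⟨l, hl, e'⟩ := h'
  exact ⟨l + k, by omega, by rw [Function.iterate_add_apply, e, e']⟩

theorem mono (h : ReachesWithin f m c c') (hmn : m ≤ n) : ReachesWithin f n c c' :=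
  let ⟨k, hk, e⟩ := h
  ⟨k, hk.trans hmn, e⟩

theorem single (h : f c = some c') : ReachesWithin f 1 c c' := ⟨1, le_rfl, h⟩

theorem head (h : f c = some c') (h' : ReachesWithin f n c' c'') :
    ReachesWithin f (n + 1) c c'' :=
  ((single h).trans h').mono (by omega)

end ReachesWithin

/-! ### One-pass automata with rewindable buffers. -/

/-- The names of the buffers of a streamer. -/
inductive Buf
  | rel
  | tup
  | sym
  deriving DecidableEq

instance : Fintype Buf := ⟨{.rel, .tup, .sym}, by rintro ⟨⟩ <;> decide⟩

/-- The operations on a buffer. -/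
inductive Op
  | keep
  | advance
  | push
  | rewind
  | clear
  deriving DecidableEq

instance : Fintype Op := ⟨{.keep, .advance, .push, .rewind, .clear}, by rintro ⟨⟩ <;> decide⟩

/-- A buffer: a word with a cursor, as the reversed part before it and the part after it. -/
abbrev Zipper (L : Type) : Type := List L × List L

/-- The effect of an operation on a buffer, when the letter read is `a`. -/
def Op.apply {L : Type} (a : Option L) : Op → Zipper L → Zipper L
  | keep, z => z
  | advance, (l, []) => (l, [])
  | advance, (l, x :: r) => (x :: l, r)
  | push, (l, r) => (a.toList ++ l, r)
  | rewind, (l, r) => ([], l.reverse ++ r)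
  | clear, _ => ([], [])

/-- A one-pass automaton with a finite control and three rewindable buffers. For each letter of the
input (and once for the end of the input) it looks at the cursor of one of the buffers, changes its
control state and performs one operation on that buffer. -/
structure Streamer (L C : Type) where
  init : C
  focus : C → Option L → Buf
  trans : C → Option L → Option L → C × Op
  accept : C → Bool

namespace Streamer

variable {L C : Type} (M : Streamer L C)

/-- One step of the automaton; `none` is the end of the input. -/
def next (s : C × (Buf → Zipper L)) (a : Option L) : C × (Buf → Zipper L) :=
  let i := M.focus s.1 a
  let p := M.trans s.1 a (s.2 i).2.head?
  (p.1, Function.update s.2 i (p.2.apply a (s.2 i)))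

/-- The effect of reading a word. -/
def feed (s : C × (Buf → Zipper L)) (w : List L) : C × (Buf → Zipper L) :=
  w.foldl (fun s x => M.next s (some x)) s

/-- The answer of the automaton on a word. -/
def verdict (w : List L) : Bool :=
  M.accept (M.next (M.feed (M.init, fun _ => ([], [])) w) none).1

/-! ### The stack machine simulating such an automaton. -/

/-- The stacks of the simulating Turing machine: input, output, and two for each buffer. -/
inductive Stack
  | inp
  | out
  | before (i : Buf)
  | after (i : Buf)
  deriving DecidableEq, Fintype

/-- The alphabets of the stacks. -/
abbrev Stack.Alphabet (L : Type) : Stack → Type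
  | .out => Bool
  | .inp | .before _ | .after _ => L

/-- The labels of the simulating Turing machine. -/
inductive Label
  | main
  | exec (i : Buf)
  | advance (i : Buf)
  | push (i : Buf)
  | rewind (i : Buf)
  | clear (i : Buf)
  | finish
  deriving Fintype

/-- The state of the simulating Turing machine: the control state, the letter read, a letter in
transit, and the operation to perform. -/
structure Reg (L C : Type) where
  ctrl : C
  inp : Option L
  scratch : Option L
  op : Op

instance [Fintype C] [Fintype L] : Finite (Reg L C) :=
  Finite.of_injective (fun v : Reg L C => (v.ctrl, v.inp, v.scratch, v.op)) <| by
    rintro ⟨⟩ ⟨⟩ h; simpa using h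

/-- The label for an operation. -/
def opLabel (i : Buf) : Op → Label
  | .keep => .main
  | .advance => .advance i
  | .push => .push i
  | .rewind => .rewind i
  | .clear => .clear i

/-- The label after a buffer has been cleared: after the end of the input all of them are. -/
def clearedLabel (i : Buf) : Option L → Label
  | some _ => .main
  | none => match i with
    | .rel => .clear .tup
    | .tup => .clear .sym
    | .sym => .finish

/-- The initial state of the simulating Turing machine. -/
def initReg : Reg L C := ⟨M.init, none, none, .keep⟩

open TM2.Stmt in
/-- The program of the simulating Turing machine. -/
def program [Inhabited L] : Label → TM2.Stmt (Stack.Alphabet L) Label (Reg L C)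
  | .main =>
    pop .inp (fun v x => { v with inp := x }) <| goto fun v => .exec (M.focus v.ctrl v.inp)
  | .exec i =>
    peek (.after i) (fun v x =>
      { v with ctrl := (M.trans v.ctrl v.inp x).1, op := (M.trans v.ctrl v.inp x).2 }) <|
    goto fun v => v.inp.elim (.clear .rel) fun _ => opLabel i v.op
  | .advance i =>
    pop (.after i) (fun v x => { v with scratch := x }) <|
    branch (fun v => v.scratch.isSome)
      (push (.before i) (fun v => (v.scratch.getD default : L)) <| goto fun _ => .main)
      (goto fun _ => .main)
  | .push i => push (.before i) (fun v => (v.inp.getD default : L)) <| goto fun _ => .main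
  | .rewind i =>
    pop (.before i) (fun v x => { v with scratch := x }) <|
    branch (fun v => v.scratch.isSome)
      (push (.after i) (fun v => (v.scratch.getD default : L)) <| goto fun _ => .rewind i)
      (goto fun _ => .main)
  | .clear i =>
    pop (.before i) (fun v x => { v with scratch := x }) <|
    branch (fun v => v.scratch.isSome) (goto fun _ => .clear i) <|
    pop (.after i) (fun v x => { v with scratch := x }) <|
    branch (fun v => v.scratch.isSome) (goto fun _ => .clear i) <|
    goto fun v => clearedLabel i v.inp
  | .finish => push .out (fun v => M.accept v.ctrl) <| load (fun _ => M.initReg) halt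

/-- The contents of the stacks. -/
def contents (w : List L) (B : Buf → Zipper L) (o : List Bool) :
    (k : Stack) → List (Stack.Alphabet L k)
  | .inp => w
  | .out => o
  | .before i => (B i).1
  | .after i => (B i).2

section Stacks

variable (w w' : List L) (B : Buf → Zipper L) (o o' : List Bool) (i : Buf) (l : List L)

theorem update_contents_inp :
    Function.update (contents w B o) .inp w' = contents w' B o := by
  funext k; cases k <;> simp [Function.update, contents]

theorem update_contents_out :
    Function.update (contents w B o) .out o' = contents w B o' := by
  funext k; cases k <;> simp [Function.update, contents]

theorem update_contents_before :
    Function.update (contents w B o) (.before i) l =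
      contents w (Function.update B i (l, (B i).2)) o := by
  funext k
  cases k with
  | before j => by_cases h : j = i
                · subst h; simp [contents]
                · simp [Function.update, contents, h]
  | after j => by_cases h : j = i
               · subst h; simp [contents]
               · simp [Function.update, contents, h]
  | _ => simp [Function.update, contents]

theorem update_contents_after :
    Function.update (contents w B o) (.after i) l =
      contents w (Function.update B i ((B i).1, l)) o := by
  funext k
  cases k with
  | before j => by_cases h : j = i
                · subst h; simp [contents]
                · simp [Function.update, contents, h]
  | after j => by_cases h : j = i
               · subst h; simp [contents]
               · simp [Function.update, contents, h]
  | _ => simp [Function.update, contents]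

end Stacks

/-- The number of letters in a buffer. -/
def _root_.WorldSet.Zipper.size (z : Zipper L) : ℕ := z.1.length + z.2.length

theorem size_apply_le (p : Op) (a : Option L) (z : Zipper L) :
    Zipper.size (p.apply a z) ≤ Zipper.size z + 1 := by
  obtain ⟨l, r⟩ := z
  cases p <;> cases r <;> cases a <;> simp [Op.apply, Zipper.size] <;> omega

theorem size_next_le (s : C × (Buf → Zipper L)) (a : Option L) (i : Buf) :
    Zipper.size ((M.next s a).2 i) ≤ Zipper.size (s.2 i) + 1 := by
  by_cases h : i = M.focus s.1 a
  · subst h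
    simpa [next] using size_apply_le _ _ _
  · simp [next, h]

/-! ### Running time of the simulation. -/

variable [Inhabited L]

/-- The step function of the simulating Turing machine. -/
abbrev tmStep : TM2.Cfg (Stack.Alphabet L) Label (Reg L C) →
    Option (TM2.Cfg (Stack.Alphabet L) Label (Reg L C)) :=
  TM2.step M.program

variable (w : List L) (B : Buf → Zipper L) (o : List Bool) (c : C) (p : Op)

theorem reaches_rewind (i : Buf) (a : L) (y : Option L) (l r : List L) (hB : B i = (l, r)) :
    ∃ y', ReachesWithin M.tmStep (l.length + 1)
      ⟨some (.rewind i), ⟨c, some a, y, p⟩, contents w B o⟩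
      ⟨some .main, ⟨c, some a, y', p⟩,
        contents w (Function.update B i ([], l.reverse ++ r)) o⟩ := by
  induction l generalizing B r y with
  | nil =>
    refine ⟨none, .single ?_⟩
    simp [tmStep, program, TM2.step, TM2.stepAux, update_contents_before, contents, hB]
  | cons x l ih =>
    obtain ⟨y', h⟩ := ih (Function.update B i (l, x :: r)) (some x) (x :: r) (by simp)
    refine ⟨y', .head ?_ (by simpa using h)⟩
    simp [tmStep, program, TM2.step, TM2.stepAux, update_contents_before, update_contents_after,
      contents, hB]

theorem reaches_clear (i : Buf) (a y : Option L) (l r : List L) (hB : B i = (l, r)) :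
    ∃ y', ReachesWithin M.tmStep (l.length + r.length + 1)
      ⟨some (.clear i), ⟨c, a, y, p⟩, contents w B o⟩
      ⟨some (clearedLabel i a), ⟨c, a, y', p⟩, contents w (Function.update B i ([], [])) o⟩ := by
  induction l generalizing B y with
  | nil =>
    induction r generalizing B y with
    | nil =>
      refine ⟨none, .single ?_⟩
      simp [tmStep, program, TM2.step, TM2.stepAux, update_contents_before, update_contents_after,
        contents, hB]
    | cons x r ih =>
      obtain ⟨y', h⟩ := ih (Function.update B i ([], r)) (some x) (by simp)
      refine ⟨y', .head ?_ (by simpa using h)⟩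
      simp [tmStep, program, TM2.step, TM2.stepAux, update_contents_before, update_contents_after,
        contents, hB]
  | cons x l ih =>
    obtain ⟨y', h⟩ := ih (Function.update B i (l, r)) (some x) (by simp)
    refine ⟨y', .mono (.head ?_ (by simpa using h)) (by simp only [List.length_cons]; omega)⟩
    simp [tmStep, program, TM2.step, TM2.stepAux, update_contents_before, update_contents_after,
      contents, hB]

/-- Two steps read the letter and consult the transition function; the operation takes one more,
except that rewinding and clearing move the letters of the buffer one by one. -/
theorem reaches_next (a : L) (y : Option L) (b : Option L) :
    ∃ y' p', ReachesWithin M.tmStep (Zipper.size (B (M.focus c (some a))) + 3)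
      ⟨some .main, ⟨c, b, y, p⟩, contents (a :: w) B o⟩
      ⟨some .main, ⟨(M.next (c, B) (some a)).1, some a, y', p'⟩,
        contents w (M.next (c, B) (some a)).2 o⟩ := by
  set i := M.focus c (some a) with hi
  set q := M.trans c (some a) (B i).2.head? with hq
  have h1 : ReachesWithin M.tmStep 2 ⟨some .main, ⟨c, b, y, p⟩, contents (a :: w) B o⟩
      ⟨some (opLabel i q.2), ⟨q.1, some a, y, q.2⟩, contents w B o⟩ := by
    refine .head (c' := ⟨some (.exec i), ⟨c, some a, y, p⟩, contents w B o⟩) ?_ (.single ?_)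
    · simp [tmStep, program, TM2.step, TM2.stepAux, update_contents_inp, contents, hi]
    · simp [tmStep, program, TM2.step, TM2.stepAux, contents, hq]
  have h2 : M.next (c, B) (some a) = (q.1, Function.update B i (q.2.apply (some a) (B i))) := rfl
  rw [h2]
  suffices ∃ y', ReachesWithin M.tmStep (Zipper.size (B i) + 1)
      ⟨some (opLabel i q.2), ⟨q.1, some a, y, q.2⟩, contents w B o⟩
      ⟨some .main, ⟨q.1, some a, y', q.2⟩,
        contents w (Function.update B i (q.2.apply (some a) (B i))) o⟩ by
    obtain ⟨y', h⟩ := this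
    exact ⟨y', q.2, (h1.trans h).mono (by omega)⟩
  generalize q.1 = c'
  generalize q.2 = p'
  rcases hB : B i with ⟨l, r⟩
  cases p' with
  | keep =>
    refine ⟨y, ?_⟩
    rw [← hB]
    simpa [Op.apply, opLabel] using ReachesWithin.refl _ _
  | advance =>
    cases r with
    | nil =>
      refine ⟨none, .mono (.single ?_) (by omega)⟩
      simp [tmStep, opLabel, program, TM2.step, TM2.stepAux, update_contents_before,
        update_contents_after, contents, hB, Op.apply]
    | cons x r =>
      refine ⟨some x, .mono (.single ?_) (by omega)⟩
      simp [tmStep, opLabel, program, TM2.step, TM2.stepAux, update_contents_before,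
        update_contents_after, contents, hB, Op.apply]
  | push =>
    refine ⟨y, .mono (.single ?_) (by omega)⟩
    simp [tmStep, opLabel, program, TM2.step, TM2.stepAux, update_contents_before, contents, hB,
      Op.apply]
  | rewind =>
    obtain ⟨y', h⟩ := M.reaches_rewind w B o c' .rewind i a y l r hB
    exact ⟨y', h.mono (by simp [Zipper.size])⟩
  | clear =>
    obtain ⟨y', h⟩ := M.reaches_clear w B o c' .clear i (some a) y l r hB
    exact ⟨y', h.mono (by simp [Zipper.size])⟩

/-- A letter of input adds at most one letter to a buffer, so buffer size plus remaining input never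
grows, and `n` bounds the buffers throughout. -/
theorem reaches_feed (n : ℕ) (hn : ∀ i, Zipper.size (B i) + w.length ≤ n) (y b : Option L) :
    ∃ y' p' b', ReachesWithin M.tmStep (w.length * (n + 3))
      ⟨some .main, ⟨c, b, y, p⟩, contents w B o⟩
      ⟨some .main, ⟨(M.feed (c, B) w).1, b', y', p'⟩, contents [] (M.feed (c, B) w).2 o⟩ ∧
      ∀ i, Zipper.size ((M.feed (c, B) w).2 i) ≤ n := by
  induction w generalizing B c p y b with
  | nil => exact ⟨y, p, b, .refl _ _, by simpa [feed] using hn⟩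
  | cons a w ih =>
    obtain ⟨y', p', h⟩ := M.reaches_next w B o c p a y b
    obtain ⟨y'', p'', b'', h', hs⟩ := ih (M.next (c, B) (some a)).2 (M.next (c, B) (some a)).1 p'
      (fun i => by
        have := M.size_next_le (c, B) (some a) i
        have hi := hn i
        dsimp only [List.length_cons] at this hi
        omega) y' (some a)
    refine ⟨y'', p'', b'', (h.trans h').mono ?_, hs⟩
    have := hn (M.focus c (some a))
    simp only [List.length_cons] at this ⊢
    nlinarith

/-- A halting configuration must have all stacks but the output empty and the register reset, hence
the three clearing rounds. -/
theorem reaches_halt (n : ℕ) (hn : ∀ i, Zipper.size (B i) ≤ n) (y b : Option L) :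
    ReachesWithin M.tmStep (3 * n + 6) ⟨some .main, ⟨c, b, y, p⟩, contents [] B []⟩
      ⟨none, M.initReg, contents [] (fun _ => ([], [])) [M.accept (M.next (c, B) none).1]⟩ := by
  set i := M.focus c none with hi
  set q := M.trans c none (B i).2.head? with hq
  have h2 : (M.next (c, B) none).1 = q.1 := rfl
  rw [h2]
  have h1 : ReachesWithin M.tmStep 2 ⟨some .main, ⟨c, b, y, p⟩, contents [] B []⟩
      ⟨some (.clear .rel), ⟨q.1, none, y, q.2⟩, contents [] B []⟩ := by
    refine .head (c' := ⟨some (.exec i), ⟨c, none, y, p⟩, contents [] B []⟩) ?_ (.single ?_)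
    · simp [tmStep, program, TM2.step, TM2.stepAux, update_contents_inp, contents, hi]
    · simp [tmStep, program, TM2.step, TM2.stepAux, contents, hq]
  obtain ⟨y1, k1⟩ := M.reaches_clear [] B [] q.1 q.2 .rel none y _ _ rfl
  set B1 := Function.update B .rel ([], []) with hB1
  obtain ⟨y2, k2⟩ := M.reaches_clear [] B1 [] q.1 q.2 .tup none y1 _ _ rfl
  set B2 := Function.update B1 .tup ([], []) with hB2
  obtain ⟨y3, k3⟩ := M.reaches_clear [] B2 [] q.1 q.2 .sym none y2 _ _ rfl
  have hB3 : Function.update B2 .sym ([], []) = fun _ => ([], []) := by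
    funext k
    cases k <;> simp [hB1, hB2, Function.update]
  rw [hB3] at k3
  have k4 : ReachesWithin M.tmStep 1
      ⟨some .finish, ⟨q.1, none, y3, q.2⟩, contents [] (fun _ => ([], [])) []⟩
      ⟨none, M.initReg, contents [] (fun _ => ([], [])) [M.accept q.1]⟩ := by
    refine .single ?_
    simp [tmStep, program, TM2.step, TM2.stepAux, update_contents_out, contents]
  refine ((((h1.trans k1).trans k2).trans k3).trans k4).mono ?_
  have e1 := hn .rel
  have e2 := hn .tup
  have e3 := hn .sym
  simp only [Zipper.size] at e1 e2 e3
  omega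

/-- The simulating Turing machine. -/
noncomputable def tm [Fintype C] [Fintype L] : FinTM2 where
  K := Stack
  k₀ := .inp
  k₁ := .out
  Γ := Stack.Alphabet L
  Λ := Label
  main := .main
  σ := Reg L C
  initialState := M.initReg
  σFin := Fintype.ofFinite _
  Γk₀Fin := inferInstanceAs (Fintype L)
  m := M.program

theorem decidableInPolyTime [Fintype C] [Fintype L] {α : Type} (enc : α → List L)
    (P : α → Prop) (h : ∀ a, M.verdict (enc a) = true ↔ P a) : DecidableInPolyTime enc P := by
  refine ⟨fun a => M.verdict (enc a), h, ⟨?_⟩⟩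
  -- The machine's input is `enc a` mapped along an identity equivalence; `l` stands for that list.
  -- The polynomial adds the bounds of `reaches_feed` and `reaches_halt`.
  have key : ∀ a (l : List L), l = enc a → Nonempty (TM2OutputsInTime M.tm l (some [M.verdict (enc a)])
      ((Polynomial.X * (Polynomial.X + 3) + (3 * Polynomial.X + 6) : Polynomial ℕ).eval
        (enc a).length)) := by
    rintro a _ rfl
    obtain ⟨y, p, b, h1, hs⟩ := M.reaches_feed (enc a) (fun _ => ([], [])) [] M.init .keep
      (enc a).length (fun i => by simp [Zipper.size]) none none
    obtain ⟨k, hk, e⟩ := h1.trans (M.reaches_halt _ _ p _ hs y b)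
    refine ⟨⟨⟨k, ?_⟩, hk.trans (by simp)⟩⟩
    have e1 : initList M.tm (enc a) = (⟨some .main, M.initReg,
        contents (enc a) (fun _ => ([], [])) []⟩ : TM2.Cfg (Stack.Alphabet L) Label (Reg L C)) := by
      unfold initList
      congr 1
      funext k
      cases k <;> rfl
    have e2 : haltList M.tm [M.verdict (enc a)] = (⟨none, M.initReg,
        contents [] (fun _ => ([], [])) [M.verdict (enc a)]⟩ :
          TM2.Cfg (Stack.Alphabet L) Label (Reg L C)) := by
      unfold haltList
      congr 1
      funext k
      cases k <;> rfl
    rw [Option.map_some, e2, e1]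
    exact e
  exact
    { tm := M.tm
      inputAlphabet := Equiv.refl L
      outputAlphabet := Equiv.refl Bool
      time := Polynomial.X * (Polynomial.X + 3) + (3 * Polynomial.X + 6)
      outputsFun := fun a => (key a _ (List.map_id _)).some }

end Streamer

-- The automaton testing certainty.

deriving instance DecidableEq for Letter

instance : Fintype Letter where
  elems := {.bit true, .bit false, .arity, .query, .const, .var, .bot, .neq, .component, .row,
    .field, .dot}
  complete := by rintro (_ | _) <;> first | decide | (rename_i b; cases b <;> decide)

instance : Inhabited Letter := ⟨.dot⟩

/-- The parts of an instance between which the control of the certainty test distinguishes. The flag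
of `sym₁` tells whether the first symbol of a negated equality is a variable, the flags of `sym₂` and
`rel` whether the comparison has succeeded so far, and the other flags whether the field being read
belongs to the relation of the query. -/
inductive Mode
  | schema
  | queryRel
  | queryTup
  | neq
  | sym₁ (isVar : Bool)
  | sym₂ (eq : Bool)
  | columns
  | rel (eq : Bool)
  | tid (active : Bool)
  | attr₀ (active : Bool)
  | attr (active : Bool)
  | val (active : Bool)
  deriving Fintype

/-- The control state of the certainty test: a negated equality of a symbol with itself or a component
containing the tuple was found; all completed rows of the component contain the tuple; some completed
tuple of the row is the tuple; the current tuple of the row agrees with the tuple so far. -/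
structure Control where
  mode : Mode
  found : Bool
  comp : Bool
  row : Bool
  mat : Bool
  deriving Fintype

namespace Control

/-- The buffer that the certainty test looks at. -/
def focus (c : Control) (a : Option Letter) : Buf :=
  match c.mode, a with
  | .queryRel, _ | .rel _, _ | .val _, some .field => .rel
  | .neq, _ | .sym₁ _, _ | .sym₂ _, _ => .sym
  | _, _ => .tup

/-- The current row contains the tuple, if it ends here; `h` is the letter at the cursor of the
tuple. -/
def rowDone (c : Control) (h : Option Letter) : Bool := c.row || (c.mat && h.isNone)

/-- The transition function of the certainty test. -/
def trans (c : Control) (a : Option Letter) (h : Option Letter) : Control × Op :=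
  match c.mode, a with
  | .schema, some .query => ({ c with mode := .queryRel }, .keep)
  | .queryRel, some (.bit _) => (c, .push)
  | .queryRel, some .const => ({ c with mode := .queryTup }, .keep)
  | .queryTup, some .neq => ({ c with mode := .neq }, .keep)
  | .queryTup, some .component => ({ c with mode := .columns, comp := true }, .keep)
  | .queryTup, some _ => (c, .push)
  | .neq, some .const => ({ c with mode := .sym₁ false }, .keep)
  | .neq, some .var => ({ c with mode := .sym₁ true }, .keep)
  | .sym₁ _, some (.bit _) => (c, .push)
  | .sym₁ v, some .const => ({ c with mode := .sym₂ (!v) }, .rewind)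
  | .sym₁ v, some .var => ({ c with mode := .sym₂ v }, .rewind)
  | .sym₂ e, some (.bit b) => ({ c with mode := .sym₂ (e && decide (h = some (.bit b))) }, .advance)
  | .sym₂ e, some .neq => ({ c with mode := .neq, found := c.found || (e && h.isNone) }, .clear)
  | .sym₂ e, some .component =>
    ({ c with mode := .columns, found := c.found || (e && h.isNone), comp := true }, .keep)
  | .sym₂ e, none => ({ c with found := c.found || (e && h.isNone) }, .keep)
  | .columns, some .row => ({ c with mode := .val false, row := false, mat := false }, .keep)
  | .columns, some .component => ({ c with found := c.found || c.comp, comp := true }, .keep)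
  | .columns, none => ({ c with found := c.found || c.comp }, .keep)
  | .rel e, some (.bit b) => ({ c with mode := .rel (e && decide (h = some (.bit b))) }, .advance)
  | .rel e, some .dot => ({ c with mode := .tid (e && h.isNone) }, .keep)
  | .tid act, some .dot => ({ c with mode := .attr₀ act }, .keep)
  | .attr₀ act, some (.bit _) => ({ c with mode := .attr act }, .keep)
  | .attr₀ true, some x =>
    ({ c with mode := .val true, row := c.rowDone h, mat := decide (x = .const) }, .rewind)
  | .attr₀ false, some _ => ({ c with mode := .val false }, .keep)
  | .attr _, some (.bit _) => (c, .keep)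
  | .attr true, some x =>
    ({ c with mode := .val true, mat := c.mat && decide (h = some x) }, .advance)
  | .attr false, some _ => ({ c with mode := .val false }, .keep)
  | .val true, some (.bit b) => ({ c with mat := c.mat && decide (h = some (.bit b)) }, .advance)
  | .val _, some .field => ({ c with mode := .rel true }, .rewind)
  | .val _, some .row =>
    ({ c with mode := .val false, comp := c.comp && c.rowDone h, row := false, mat := false }, .keep)
  | .val _, some .component =>
    ({ c with mode := .columns, found := c.found || (c.comp && c.rowDone h), comp := true }, .keep)
  | .val _, none => ({ c with found := c.found || (c.comp && c.rowDone h) }, .keep)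
  | _, _ => (c, .keep)

end Control

/-- The certainty test. -/
def certainty : Streamer Letter Control where
  init := ⟨.schema, false, false, false, false⟩
  focus := Control.focus
  trans := Control.trans
  accept c := c.found

/-- The buffers with given contents. -/
def bufs (zr zt zs : Zipper Letter) : Buf → Zipper Letter
  | .rel => zr
  | .tup => zt
  | .sym => zs

section Bufs

variable (zr zt zs z : Zipper Letter)

@[simp]
theorem update_bufs_rel : Function.update (bufs zr zt zs) .rel z = bufs z zt zs := by
  funext i; cases i <;> simp [Function.update, bufs]

@[simp]
theorem update_bufs_tup : Function.update (bufs zr zt zs) .tup z = bufs zr z zs := by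
  funext i; cases i <;> simp [Function.update, bufs]

@[simp]
theorem update_bufs_sym : Function.update (bufs zr zt zs) .sym z = bufs zr zt z := by
  funext i; cases i <;> simp [Function.update, bufs]

end Bufs

/-! ### Reading concatenated words. -/

namespace Streamer

variable {L C : Type} (M : Streamer L C) (s : C × (Buf → Zipper L))

theorem feed_nil : M.feed s [] = s := rfl

theorem feed_cons (a : L) (w : List L) : M.feed s (a :: w) = M.feed (M.next s (some a)) w := rfl

theorem feed_append (u v : List L) : M.feed s (u ++ v) = M.feed (M.feed s u) v :=
  List.foldl_append ..

theorem feed_eq_self {w : List L} (h : ∀ a ∈ w, M.next s (some a) = s) : M.feed s w = s := by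
  induction w with
  | nil => rfl
  | cons a w ih =>
    rw [feed_cons, h a (by simp), ih fun b hb => h b (by simp [hb])]

variable {s}

/-- An invariant indexed by a proposition lets the control accumulate an existential search over a
list; `feed_flatMap_and` does the same for a universal one. -/
theorem feed_flatMap_or {ι : Type*} (R : Prop → C × (Buf → Zipper L) → Prop) (g : ι → List L)
    (q : ι → Prop) (l : List ι)
    (h : ∀ i ∈ l, ∀ p s, R p s → R (p ∨ q i) (M.feed s (g i))) {p : Prop} (hs : R p s) :
    R (p ∨ ∃ i ∈ l, q i) (M.feed s (l.flatMap g)) := by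
  induction l generalizing p s with
  | nil => simpa [feed_nil] using hs
  | cons i l ih =>
    rw [List.flatMap_cons, feed_append]
    have := ih (fun j hj => h j (by simp [hj])) (h i (by simp) p s hs)
    simpa [or_assoc] using this

theorem feed_flatMap_and {ι : Type*} (R : Prop → C × (Buf → Zipper L) → Prop) (g : ι → List L)
    (q : ι → Prop) (l : List ι)
    (h : ∀ i ∈ l, ∀ p s, R p s → R (p ∧ q i) (M.feed s (g i))) {p : Prop} (hs : R p s) :
    R (p ∧ ∀ i ∈ l, q i) (M.feed s (l.flatMap g)) := by
  induction l generalizing p s with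
  | nil => simpa [feed_nil] using hs
  | cons i l ih =>
    rw [List.flatMap_cons, feed_append]
    have := ih (fun j hj => h j (by simp [hj])) (h i (by simp) p s hs)
    simpa [and_assoc] using this

end Streamer

/-! ### Buffers as words with a cursor, and incremental comparison. -/

/-- The word of a buffer. -/
def Zipper.word {L : Type} (z : Zipper L) : List L := z.1.reverse ++ z.2

/-- The buffer of the word `v` with its cursor at `n`. -/
def zipAt {L : Type} (v : List L) (n : ℕ) : Zipper L := ((v.take n).reverse, v.drop n)

section Zipper

variable {L : Type}

theorem word_zipAt (v : List L) (n : ℕ) : (zipAt v n).word = v := by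
  simp [Zipper.word, zipAt]

theorem rewind_apply (a : Option L) (z : Zipper L) : Op.rewind.apply a z = zipAt z.word 0 := by
  simp [Op.apply, Zipper.word, zipAt]

/-- Past the end both sides are stationary, so no bound on `n` is needed and a comparison may run
beyond the stored word. -/
theorem advance_zipAt (a : Option L) (v : List L) (n : ℕ) :
    Op.advance.apply a (zipAt v n) = zipAt v (n + 1) := by
  unfold zipAt
  rcases h : v.drop n with _ | ⟨x, r⟩
  · have h' : v.length ≤ n := List.drop_eq_nil_iff.1 h
    rw [List.drop_eq_nil_of_le (by omega : v.length ≤ n + 1), List.take_of_length_le h',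
      List.take_of_length_le (by omega : v.length ≤ n + 1)]
    rfl
  · have hn : n < v.length := by
      by_contra hn
      rw [List.drop_eq_nil_of_le (by omega)] at h
      cases h
    rw [List.drop_eq_getElem_cons hn] at h
    injection h with h1 h2
    rw [h2, ← List.take_concat_get' v n hn, h1]
    simp [Op.apply]

theorem head?_zipAt (v : List L) (n : ℕ) : (zipAt v n).2.head? = v[n]? := by
  simp [zipAt]

variable [DecidableEq L]

theorem decide_prefix_snoc (u v : List L) (x : L) :
    decide (u ++ [x] <+: v) = (decide (u <+: v) && decide (v[u.length]? = some x)) := by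
  rw [← Bool.decide_and, decide_eq_decide]
  constructor
  · rintro ⟨t, rfl⟩
    exact ⟨⟨x :: t, by simp⟩, by simp⟩
  · rintro ⟨⟨t, rfl⟩, h⟩
    rcases t with _ | ⟨y, t⟩
    · simp at h
    · obtain rfl : y = x := by simpa using h
      exact ⟨t, by simp⟩

/-- Comparisons maintain only a prefix test; a cursor at the end of the buffer upgrades it to
equality. -/
theorem prefix_and_isNone (u v : List L) :
    (decide (u <+: v) && (zipAt v u.length).2.head?.isNone) = decide (u = v) := by
  rw [Bool.eq_iff_iff]
  simp only [zipAt, Bool.and_eq_true, decide_eq_true_eq, List.head?_drop,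
    Option.isNone_iff_eq_none, List.getElem?_eq_none_iff]
  constructor
  · rintro ⟨h, h'⟩
    exact h.eq_of_length_le h'
  · rintro rfl
    exact ⟨List.prefix_rfl, le_rfl⟩

end Zipper

/-! ### Storing bits and comparing them with a buffer. -/

section Reading

variable (f c r m e : Bool) (zr zt zs : Zipper Letter)

theorem feed_queryRel (l : List Bool) :
    certainty.feed (⟨.queryRel, f, c, r, m⟩, bufs zr zt zs) (bitsWord l) =
      (⟨.queryRel, f, c, r, m⟩, bufs ((bitsWord l).reverse ++ zr.1, zr.2) zt zs) := by
  induction l generalizing zr with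
  | nil => rfl
  | cons b l ih =>
    have h : certainty.next (⟨.queryRel, f, c, r, m⟩, bufs zr zt zs) (some (.bit b)) =
        (⟨.queryRel, f, c, r, m⟩, bufs (.bit b :: zr.1, zr.2) zt zs) := by
      simp [Streamer.next, certainty, Control.focus, Control.trans, bufs, Op.apply]
    rw [bitsWord, List.map_cons, Streamer.feed_cons, h]
    refine (ih _).trans ?_
    simp [bitsWord]

theorem feed_queryTup (w : List Letter) (hw : ∀ x ∈ w, x ≠ .neq ∧ x ≠ .component) :
    certainty.feed (⟨.queryTup, f, c, r, m⟩, bufs zr zt zs) w =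
      (⟨.queryTup, f, c, r, m⟩, bufs zr (w.reverse ++ zt.1, zt.2) zs) := by
  induction w generalizing zt with
  | nil => rfl
  | cons x w ih =>
    have h : certainty.next (⟨.queryTup, f, c, r, m⟩, bufs zr zt zs) (some x) =
        (⟨.queryTup, f, c, r, m⟩, bufs zr (x :: zt.1, zt.2) zs) := by
      have := hw x (by simp)
      cases x <;>
        simp_all [Streamer.next, certainty, Control.focus, Control.trans, bufs, Op.apply]
    rw [Streamer.feed_cons, h, ih _ fun y hy => hw y (by simp [hy])]
    simp

theorem feed_sym₁ (v : Bool) (l : List Bool) :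
    certainty.feed (⟨.sym₁ v, f, c, r, m⟩, bufs zr zt zs) (bitsWord l) =
      (⟨.sym₁ v, f, c, r, m⟩, bufs zr zt ((bitsWord l).reverse ++ zs.1, zs.2)) := by
  induction l generalizing zs with
  | nil => rfl
  | cons b l ih =>
    have h : certainty.next (⟨.sym₁ v, f, c, r, m⟩, bufs zr zt zs) (some (.bit b)) =
        (⟨.sym₁ v, f, c, r, m⟩, bufs zr zt (.bit b :: zs.1, zs.2)) := by
      simp [Streamer.next, certainty, Control.focus, Control.trans, bufs, Op.apply]
    rw [bitsWord, List.map_cons, Streamer.feed_cons, h]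
    refine (ih _).trans ?_
    simp [bitsWord]

/-- The cursor advances even after a mismatch, so its position is determined by the letters
compared, and `decide_prefix_snoc` updates the flag. The factor `e` carries earlier verdicts.
`feed_rel` and `feed_val` follow the same pattern. -/
theorem feed_sym₂ (l : List Bool) (u v : List Letter) :
    certainty.feed (⟨.sym₂ (e && decide (u <+: v)), f, c, r, m⟩, bufs zr zt (zipAt v u.length))
        (bitsWord l) =
      (⟨.sym₂ (e && decide (u ++ bitsWord l <+: v)), f, c, r, m⟩,
        bufs zr zt (zipAt v (u ++ bitsWord l).length)) := by
  induction l generalizing u with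
  | nil => simp [bitsWord, Streamer.feed_nil]
  | cons b l ih =>
    have h : certainty.next (⟨.sym₂ (e && decide (u <+: v)), f, c, r, m⟩,
          bufs zr zt (zipAt v u.length)) (some (.bit b)) =
        (⟨.sym₂ (e && decide (u ++ [Letter.bit b] <+: v)), f, c, r, m⟩,
          bufs zr zt (zipAt v (u ++ [Letter.bit b]).length)) := by
      rw [decide_prefix_snoc, ← head?_zipAt]
      simp [Streamer.next, certainty, Control.focus, Control.trans, bufs, advance_zipAt,
        Bool.and_assoc]
    rw [bitsWord, List.map_cons, Streamer.feed_cons, h]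
    refine (ih _).trans ?_
    simp [bitsWord]

theorem feed_rel (l : List Bool) (u v : List Letter) :
    certainty.feed (⟨.rel (e && decide (u <+: v)), f, c, r, m⟩, bufs (zipAt v u.length) zt zs)
        (bitsWord l) =
      (⟨.rel (e && decide (u ++ bitsWord l <+: v)), f, c, r, m⟩,
        bufs (zipAt v (u ++ bitsWord l).length) zt zs) := by
  induction l generalizing u with
  | nil => simp [bitsWord, Streamer.feed_nil]
  | cons b l ih =>
    have h : certainty.next (⟨.rel (e && decide (u <+: v)), f, c, r, m⟩,
          bufs (zipAt v u.length) zt zs) (some (.bit b)) =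
        (⟨.rel (e && decide (u ++ [Letter.bit b] <+: v)), f, c, r, m⟩,
          bufs (zipAt v (u ++ [Letter.bit b]).length) zt zs) := by
      rw [decide_prefix_snoc, ← head?_zipAt]
      simp [Streamer.next, certainty, Control.focus, Control.trans, bufs, advance_zipAt,
        Bool.and_assoc]
    rw [bitsWord, List.map_cons, Streamer.feed_cons, h]
    refine (ih _).trans ?_
    simp [bitsWord]

theorem feed_val (l : List Bool) (u v : List Letter) :
    certainty.feed (⟨.val true, f, c, r, e && decide (u <+: v)⟩, bufs zr (zipAt v u.length) zs)
        (bitsWord l) =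
      (⟨.val true, f, c, r, e && decide (u ++ bitsWord l <+: v)⟩,
        bufs zr (zipAt v (u ++ bitsWord l).length) zs) := by
  induction l generalizing u with
  | nil => simp [bitsWord, Streamer.feed_nil]
  | cons b l ih =>
    have h : certainty.next (⟨.val true, f, c, r, e && decide (u <+: v)⟩,
          bufs zr (zipAt v u.length) zs) (some (.bit b)) =
        (⟨.val true, f, c, r, e && decide (u ++ [Letter.bit b] <+: v)⟩,
          bufs zr (zipAt v (u ++ [Letter.bit b]).length) zs) := by
      rw [decide_prefix_snoc, ← head?_zipAt]
      simp [Streamer.next, certainty, Control.focus, Control.trans, bufs, advance_zipAt,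
        Bool.and_assoc]
    rw [bitsWord, List.map_cons, Streamer.feed_cons, h]
    refine (ih _).trans ?_
    simp [bitsWord]

end Reading

/-! ### Unique readability of the encoding. -/

section Words

variable {D : Type u} {X : Type v} {encD : D → List Bool} {encX : X → List Bool}

/-- The word does not begin with a bit. -/
def NoBit (w : List Letter) : Prop := ∀ b, w.head? ≠ some (.bit b)

/-- A bit string is delimited by the first letter that is not a bit. -/
theorem bitsWord_append_inj {l l' : List Bool} {w w' : List Letter} (hw : NoBit w)
    (hw' : NoBit w') (h : bitsWord l ++ w = bitsWord l' ++ w') : l = l' ∧ w = w' := by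
  induction l generalizing l' with
  | nil =>
    cases l' with
    | nil => exact ⟨rfl, h⟩
    | cons b l' => exact absurd (congrArg List.head? h) (hw b)
  | cons b l ih =>
    cases l' with
    | nil => exact absurd (congrArg List.head? h).symm (hw' b)
    | cons b' l' =>
      simp only [bitsWord, List.map_cons, List.cons_append, List.cons.injEq,
        Letter.bit.injEq] at h
      obtain ⟨rfl, h⟩ := h
      obtain ⟨rfl, h'⟩ := ih h
      exact ⟨rfl, h'⟩

theorem noBit_nil : NoBit [] := fun _ h => by cases h

theorem bitsWord_injective : Function.Injective bitsWord := fun l l' h =>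
  (bitsWord_append_inj noBit_nil noBit_nil (by simpa using h)).1

theorem natWord_inj {m n : ℕ} : natWord m = natWord n ↔ m = n := by
  refine ⟨fun h => ?_, fun h => by rw [h]⟩
  have := bitsWord_injective h
  rw [← Computability.decode_encodeNat m, this, Computability.decode_encodeNat]

/-- The letter that tells the kind of a value. -/
def valMark : Val D X → Letter
  | .sym (.const _) => .const
  | .sym (.var _) => .var
  | .bot => .bot

/-- The bits of a value. -/
def valBits (encD : D → List Bool) (encX : X → List Bool) : Val D X → List Bool
  | .sym (.const c) => encD c
  | .sym (.var x) => encX x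
  | .bot => []

theorem valWord_eq (v : Val D X) :
    valWord encD encX v = valMark v :: bitsWord (valBits encD encX v) := by
  rcases v with (_ | _) | _ <;> rfl

theorem valMark_ne_bit (v : Val D X) (b : Bool) : valMark v ≠ .bit b := by
  rcases v with (_ | _) | _ <;> simp [valMark]

theorem valWord_append_inj (hD : Function.Injective encD) (hX : Function.Injective encX)
    {v v' : Val D X} {w w' : List Letter} (hw : NoBit w) (hw' : NoBit w')
    (h : valWord encD encX v ++ w = valWord encD encX v' ++ w') : v = v' ∧ w = w' := by
  rw [valWord_eq, valWord_eq, List.cons_append, List.cons_append, List.cons.injEq] at h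
  obtain ⟨h1, h2⟩ := h
  obtain ⟨h2, h3⟩ := bitsWord_append_inj hw hw' h2
  refine ⟨?_, h3⟩
  rcases v with (c | x) | _ <;> rcases v' with (c' | x') | _ <;> simp_all [valMark, valBits]
  · exact hD h2
  · exact hX h2

theorem symbWord_injective (hD : Function.Injective encD) (hX : Function.Injective encX) :
    Function.Injective (symbWord encD encX) := fun s s' h => by
  have h' : valWord encD encX (.sym s) ++ [] = valWord encD encX (.sym s') ++ [] := by
    simpa [valWord] using h
  injection (valWord_append_inj hD hX noBit_nil noBit_nil h').1

theorem noBit_flatMap_valWord {ι : Type*} (l : List ι) (g : ι → Val D X) :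
    NoBit (l.flatMap fun i => valWord encD encX (g i)) := by
  cases l with
  | nil => exact noBit_nil
  | cons i l =>
    intro b
    rw [List.flatMap_cons, valWord_eq]
    simpa using valMark_ne_bit (g i) b

/-- Each value begins with a mark that is not a bit, so concatenated values can be split again. -/
theorem flatMap_valWord_inj (hD : Function.Injective encD) (hX : Function.Injective encX)
    {ι : Type*} {l : List ι} {g g' : ι → Val D X} :
    (l.flatMap fun i => valWord encD encX (g i)) =
      (l.flatMap fun i => valWord encD encX (g' i)) ↔ ∀ i ∈ l, g i = g' i := by
  induction l with
  | nil => simp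
  | cons i l ih =>
    rw [List.flatMap_cons, List.flatMap_cons, List.forall_mem_cons, ← ih]
    constructor
    · exact valWord_append_inj hD hX (noBit_flatMap_valWord _ _) (noBit_flatMap_valWord _ _)
    · rintro ⟨h, h'⟩
      rw [h, h']

end Words

/-! ### Reading field names. -/

section Fields

theorem trans_attr (f c r m : Bool) {x : Letter} (hx : ∀ b, x ≠ .bit b) (h : Option Letter) :
    Control.trans ⟨.attr true, f, c, r, m⟩ (some x) h =
      (⟨.val true, f, c, r, m && decide (h = some x)⟩, .advance) := by
  cases x <;> first | rfl | exact absurd rfl (hx _)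

theorem trans_attr₀ (f c r m : Bool) {x : Letter} (hx : ∀ b, x ≠ .bit b) (h : Option Letter) :
    Control.trans ⟨.attr₀ true, f, c, r, m⟩ (some x) h =
      (⟨.val true, f, c, r || (m && h.isNone), decide (x = .const)⟩, .rewind) := by
  cases x <;> first | rfl | exact absurd rfl (hx _)

variable (f c r m e : Bool) (zr zt zs : Zipper Letter)

theorem feed_natWord_tid (act : Bool) (n : ℕ) :
    certainty.feed (⟨.tid act, f, c, r, m⟩, bufs zr zt zs) (natWord n) =
      (⟨.tid act, f, c, r, m⟩, bufs zr zt zs) := by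
  refine certainty.feed_eq_self _ fun x hx => ?_
  obtain ⟨b, -, rfl⟩ := List.mem_map.1 hx
  simp [Streamer.next, certainty, Control.focus, Control.trans, bufs, Op.apply]

/-- Zero is the only number written as the empty word, so the control recognizes the first
attribute, and with it the start of a new tuple, by the absence of bits. -/
theorem feed_natWord_attr₀ (act : Bool) (n : ℕ) :
    certainty.feed (⟨.attr₀ act, f, c, r, m⟩, bufs zr zt zs) (natWord n) =
      (⟨if n = 0 then .attr₀ act else .attr act, f, c, r, m⟩, bufs zr zt zs) := by
  rcases h : natWord n with _ | ⟨x, w⟩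
  · have : n = 0 := natWord_inj.1 (h.trans rfl)
    rw [if_pos this, Streamer.feed_nil]
  · have hn : n ≠ 0 := by
      rintro rfl
      cases h
    have hx : ∀ y ∈ x :: w, ∃ b, y = .bit b := by
      intro y hy
      rw [← h] at hy
      obtain ⟨b, -, rfl⟩ := List.mem_map.1 hy
      exact ⟨b, rfl⟩
    obtain ⟨b, rfl⟩ := hx x (by simp)
    rw [if_neg hn, Streamer.feed_cons]
    have h1 : certainty.next (⟨.attr₀ act, f, c, r, m⟩, bufs zr zt zs) (some (.bit b)) =
        (⟨.attr act, f, c, r, m⟩, bufs zr zt zs) := by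
      simp [Streamer.next, certainty, Control.focus, Control.trans, bufs, Op.apply]
    rw [h1]
    refine certainty.feed_eq_self _ fun y hy => ?_
    obtain ⟨b', rfl⟩ := hx y (by simp [hy])
    cases act <;> simp [Streamer.next, certainty, Control.focus, Control.trans, bufs, Op.apply]

/-- The relation name is compared with the stored one. The identifier is skipped: attribute zero
already separates the tuples. -/
theorem feed_fieldWord {S : Schema} {n : Fin S.k → ℕ} (act : Bool) (i : TField S n) (q : Fin S.k)
    (hzr : zr.word = natWord q) :
    ∃ zr', zr'.word = natWord q ∧
      certainty.feed (⟨.val act, f, c, r, m⟩, bufs zr zt zs) (fieldWord i) =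
        (⟨if (i.attr : ℕ) = 0 then .attr₀ (decide (i.rel = q)) else .attr (decide (i.rel = q)),
          f, c, r, m⟩, bufs zr' zt zs) := by
  refine ⟨zipAt (natWord q) (natWord i.rel).length, word_zipAt _ _, ?_⟩
  -- The flag is written as a prefix test of the empty word, to match the starting case of
  -- `feed_rel`.
  have h1 : certainty.next (⟨.val act, f, c, r, m⟩, bufs zr zt zs) (some .field) =
      (⟨.rel (true && decide ([] <+: natWord q)), f, c, r, m⟩,
        bufs (zipAt (natWord q) ([] : List Letter).length) zt zs) := by
    cases act <;>
      simp [Streamer.next, certainty, Control.focus, Control.trans, bufs, rewind_apply, hzr]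
  have h2 : certainty.next (⟨.rel (decide (natWord i.rel <+: natWord q)), f, c, r, m⟩,
        bufs (zipAt (natWord q) (natWord i.rel).length) zt zs) (some .dot) =
      (⟨.tid (decide (i.rel = q)), f, c, r, m⟩,
        bufs (zipAt (natWord q) (natWord i.rel).length) zt zs) := by
    have : (decide (i.rel = q)) = decide (natWord i.rel = natWord q) := by
      simp [natWord_inj, Fin.ext_iff]
    rw [this, ← prefix_and_isNone]
    simp [Streamer.next, certainty, Control.focus, Control.trans, bufs, Op.apply]
  have h3 (act : Bool) (z : Zipper Letter) :
      certainty.next (⟨.tid act, f, c, r, m⟩, bufs z zt zs) (some .dot) =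
        (⟨.attr₀ act, f, c, r, m⟩, bufs z zt zs) := by
    simp [Streamer.next, certainty, Control.focus, Control.trans, bufs, Op.apply]
  have h4 := feed_rel f c r m true zt zs (Computability.encodeNat i.rel) [] (natWord q)
  rw [← natWord] at h4
  simp only [List.nil_append, Bool.true_and] at h4 h1
  simp only [fieldWord, List.cons_append, List.append_assoc, Streamer.feed_cons,
    Streamer.feed_append]
  rw [h1, h4, h2, feed_natWord_tid, h3, feed_natWord_attr₀]

end Fields

/-! ### Reading the tuples of a row. -/

section Rows

variable {D : Type u} {X : Type v} (encD : D → List Bool) (encX : X → List Bool)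
variable {S : Schema} {n : Fin S.k → ℕ} (q : Fin S.k) (tw : List Letter)

/-- The word of a list of fields and their values. -/
def fieldsWord (l : List (TField S n)) (g : TField S n → Val D X) : List Letter :=
  l.flatMap fun i => fieldWord i ++ valWord encD encX (g i)

/-- Fields of other relations leave the match flag and the tuple buffer alone, so the pending
verdict on the last relevant tuple survives them. -/
theorem feed_fields_inactive (f c r m : Bool) (zt zs : Zipper Letter) (g : TField S n → Val D X)
    (l : List (TField S n)) (hl : ∀ i ∈ l, i.rel ≠ q) (zr : Zipper Letter)
    (hzr : zr.word = natWord q) (act : Bool) :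
    ∃ zr' act', zr'.word = natWord q ∧
      certainty.feed (⟨.val act, f, c, r, m⟩, bufs zr zt zs) (fieldsWord encD encX l g) =
        (⟨.val act', f, c, r, m⟩, bufs zr' zt zs) := by
  induction l generalizing zr act with
  | nil => exact ⟨zr, act, hzr, rfl⟩
  | cons i l ih =>
    obtain ⟨zr₁, h₁, e₁⟩ := feed_fieldWord f c r m zr zt zs act i q hzr
    obtain ⟨zr₂, act₂, h₂, e₂⟩ := ih (fun j hj => hl j (by simp [hj])) zr₁ h₁ false
    refine ⟨zr₂, act₂, h₂, ?_⟩
    rw [fieldsWord, List.flatMap_cons, Streamer.feed_append, Streamer.feed_append, e₁,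
      valWord_eq, Streamer.feed_cons, decide_eq_false (hl i (by simp))]
    have h : certainty.next (⟨if (i.attr : ℕ) = 0 then .attr₀ false else .attr false, f, c, r, m⟩,
        bufs zr₁ zt zs) (some (valMark (g i))) = (⟨.val false, f, c, r, m⟩, bufs zr₁ zt zs) := by
      rcases g i with (_ | _) | _ <;> split_ifs <;>
        simp [Streamer.next, certainty, Control.focus, Control.trans, bufs, Op.apply, valMark]
    rw [h, certainty.feed_eq_self (w := bitsWord _)]
    · exact e₂
    · intro x hx
      obtain ⟨b, -, rfl⟩ := List.mem_map.1 hx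
      simp [Streamer.next, certainty, Control.focus, Control.trans, bufs, Op.apply]

theorem feed_fields_active (f c r e : Bool) (zs : Zipper Letter) (g : TField S n → Val D X)
    (l : List (TField S n)) (hl : ∀ i ∈ l, i.rel = q ∧ (i.attr : ℕ) ≠ 0) (zr : Zipper Letter)
    (hzr : zr.word = natWord q) (w : List Letter) :
    ∃ zr', zr'.word = natWord q ∧
      certainty.feed (⟨.val true, f, c, r, e && decide (w <+: tw)⟩,
          bufs zr (zipAt tw w.length) zs) (fieldsWord encD encX l g) =
        (⟨.val true, f, c, r,
            e && decide (w ++ (l.flatMap fun i => valWord encD encX (g i)) <+: tw)⟩,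
          bufs zr' (zipAt tw (w ++ l.flatMap fun i => valWord encD encX (g i)).length) zs) := by
  induction l generalizing zr w with
  | nil => exact ⟨zr, hzr, by simp [fieldsWord, Streamer.feed_nil]⟩
  | cons i l ih =>
    obtain ⟨zr₁, h₁, e₁⟩ := feed_fieldWord f c r (e && decide (w <+: tw)) zr (zipAt tw w.length)
      zs true i q hzr
    obtain ⟨zr₂, h₂, e₂⟩ := ih (fun j hj => hl j (by simp [hj])) zr₁ h₁
      (w ++ valWord encD encX (g i))
    refine ⟨zr₂, h₂, ?_⟩
    obtain ⟨hi, hi'⟩ := hl i (by simp)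
    rw [fieldsWord, List.flatMap_cons, Streamer.feed_append, Streamer.feed_append, e₁,
      valWord_eq, Streamer.feed_cons, decide_eq_true hi, if_neg hi']
    have h : certainty.next (⟨.attr true, f, c, r, e && decide (w <+: tw)⟩,
        bufs zr₁ (zipAt tw w.length) zs) (some (valMark (g i))) =
        (⟨.val true, f, c, r, e && decide (w ++ [valMark (g i)] <+: tw)⟩,
          bufs zr₁ (zipAt tw (w ++ [valMark (g i)]).length) zs) := by
      rw [decide_prefix_snoc, ← head?_zipAt]
      simp [Streamer.next, certainty, Control.focus, trans_attr _ _ _ _ (valMark_ne_bit (g i)),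
        bufs, advance_zipAt, Bool.and_assoc]
    rw [h, feed_val]
    rw [valWord_eq] at e₂
    simpa [valWord_eq, fieldsWord] using e₂

/-- The state of the certainty test between two tuples of a row. A negated equality of a symbol with
itself or a component containing the tuple was found if `b`, all previous rows of the component
contain the tuple if `c`, and some of the tuples of this row is the tuple if `p`. -/
def RowState (b c p : Prop) (s : Control × (Buf → Zipper Letter)) : Prop :=
  ∃ act f c' r m zr zt zs, s = (⟨.val act, f, c', r, m⟩, bufs zr zt zs) ∧
    zr.word = natWord q ∧ zt.word = tw ∧ (f = true ↔ b) ∧ (c' = true ↔ c) ∧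
    ((r || (m && zt.2.head?.isNone)) = true ↔ p)

variable {q tw} {b c p : Prop} {s : Control × (Buf → Zipper Letter)}

theorem RowState.feed_inactive (h : RowState q tw b c p s) (g : TField S n → Val D X)
    (l : List (TField S n)) (hl : ∀ i ∈ l, i.rel ≠ q) :
    RowState q tw b c p (certainty.feed s (fieldsWord encD encX l g)) := by
  obtain ⟨act, f, c', r, m, zr, zt, zs, rfl, h1, h2, h3, h4, h5⟩ := h
  obtain ⟨zr', act', h1', e⟩ := feed_fields_inactive encD encX q f c' r m zt zs g l hl zr h1 act
  exact ⟨act', f, c', r, m, zr', zt, zs, e, h1', h2, h3, h4, h5⟩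

/-- At the first mark the only available buffer operation is spent on rewinding. Hence the buffer
`tw` omits the leading `.const` of the tuple, and the control checks that mark itself. -/
theorem RowState.feed_active (h : RowState q tw b c p s) (g : TField S n → Val D X)
    (i : TField S n) (l : List (TField S n)) (hi : i.rel = q) (hi' : (i.attr : ℕ) = 0)
    (hl : ∀ i ∈ l, i.rel = q ∧ (i.attr : ℕ) ≠ 0) :
    RowState q tw b c
      (p ∨ ((i :: l).flatMap fun i => valWord encD encX (g i)) = .const :: tw)
      (certainty.feed s (fieldsWord encD encX (i :: l) g)) := by
  obtain ⟨act, f, c', r, m, zr, zt, zs, rfl, h1, h2, h3, h4, h5⟩ := h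
  obtain ⟨zr₁, h₁, e₁⟩ := feed_fieldWord f c' r m zr zt zs act i q h1
  -- The start of a new tuple settles the verdict pending on the previous one.
  set r' := r || (m && zt.2.head?.isNone) with hr'
  set e := decide (valMark (g i) = .const) with he
  set w := bitsWord (valBits encD encX (g i)) with hw
  obtain ⟨zr₂, h₂, e₂⟩ := feed_fields_active encD encX q tw f c' r' e zs g l hl zr₁ h₁ w
  have hfin : certainty.feed (⟨.val act, f, c', r, m⟩, bufs zr zt zs)
      (fieldsWord encD encX (i :: l) g) =
      (⟨.val true, f, c', r',
            e && decide (w ++ (l.flatMap fun i => valWord encD encX (g i)) <+: tw)⟩,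
          bufs zr₂ (zipAt tw (w ++ l.flatMap fun i => valWord encD encX (g i)).length) zs) := by
    rw [fieldsWord, List.flatMap_cons, Streamer.feed_append, Streamer.feed_append, e₁,
      valWord_eq, Streamer.feed_cons, decide_eq_true hi, if_pos hi']
    have h : certainty.next (⟨.attr₀ true, f, c', r, m⟩, bufs zr₁ zt zs)
        (some (valMark (g i))) =
        (⟨.val true, f, c', r', e && decide ([] <+: tw)⟩,
          bufs zr₁ (zipAt tw ([] : List Letter).length) zs) := by
      rw [hr', he]
      simp [Streamer.next, certainty, Control.focus, trans_attr₀ _ _ _ _ (valMark_ne_bit (g i)),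
        bufs, rewind_apply, h2]
    rw [h, feed_val]
    exact e₂
  refine ⟨_, _, _, _, _, _, _, _, hfin, h₂, word_zipAt _ _, h3, h4, ?_⟩
  rw [Bool.and_assoc, prefix_and_isNone, Bool.or_eq_true, h5, Bool.and_eq_true, he,
    decide_eq_true_eq, decide_eq_true_eq, List.flatMap_cons, valWord_eq, List.cons_append,
    List.cons.injEq]

end Rows

/-! ### Reading the components. -/

section Components

variable {D : Type u} {X : Type v} (encD : D → List Bool) (encX : X → List Bool)
variable {S : Schema} (q : Fin S.k) (tw : List Letter)

/-- The certainty test can read a component next. A negated equality of a symbol with itself or a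
component containing the tuple was found if `b`. -/
def CompReady (b : Prop) (s : Control × (Buf → Zipper Letter)) : Prop :=
  (∃ f r m zr zt zs, certainty.next s (some .component) =
      (⟨.columns, f, true, r, m⟩, bufs zr zt zs) ∧
    zr.word = natWord q ∧ zt.word = tw ∧ (f = true ↔ b)) ∧
  ((certainty.next s none).1.found = true ↔ b)

/-- The certainty test can read a row next, or another component. The proposition `c` tells whether
all rows of the present component so far contain the tuple. -/
def RowReady (b c : Prop) (s : Control × (Buf → Zipper Letter)) : Prop :=
  (∃ f c' zr zt zs, certainty.next s (some .row) =
      (⟨.val false, f, c', false, false⟩, bufs zr zt zs) ∧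
    zr.word = natWord q ∧ zt.word = tw ∧ (f = true ↔ b) ∧ (c' = true ↔ c)) ∧
  CompReady q tw (b ∨ c) s

/-- The certainty test can read a negated equality next, or a component. -/
def CondReady (b : Prop) (s : Control × (Buf → Zipper Letter)) : Prop :=
  (∃ f zr zt, certainty.next s (some .neq) =
      (⟨.neq, f, false, false, false⟩, bufs zr zt ([], [])) ∧
    zr.word = natWord q ∧ zt.word = tw ∧ (f = true ↔ b)) ∧
  CompReady q tw b s

variable {q tw} {b c p : Prop} {s : Control × (Buf → Zipper Letter)}

/-- The end of a row is noticed only at the next letter or the end of the input; each of these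
continuations folds the pending verdict in. -/
theorem RowState.rowReady (h : RowState q tw b c p s) : RowReady q tw b (c ∧ p) s := by
  obtain ⟨act, f, c', r, m, zr, zt, zs, rfl, h1, h2, h3, h4, h5⟩ := h
  have hc : (c' && (r || (m && zt.2.head?.isNone))) = true ↔ c ∧ p := by
    rw [Bool.and_eq_true, h4, h5]
  have hf : (f || (c' && (r || (m && zt.2.head?.isNone)))) = true ↔ b ∨ c ∧ p := by
    rw [Bool.or_eq_true, hc, h3]
  refine ⟨⟨f, _, zr, zt, zs, ?_, h1, h2, h3, hc⟩,
    ⟨_, r, m, zr, zt, zs, ?_, h1, h2, hf⟩, ?_⟩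
  · cases act <;> simp [Streamer.next, certainty, Control.focus, Control.trans, Control.rowDone,
      bufs, Op.apply]
  · cases act <;> simp [Streamer.next, certainty, Control.focus, Control.trans, Control.rowDone,
      bufs, Op.apply]
  · rw [← hf]
    cases act <;> simp [Streamer.next, certainty, Control.focus, Control.trans, Control.rowDone,
      bufs]

theorem RowReady.rowState_next (h : RowReady q tw b c s) :
    RowState q tw b c False (certainty.next s (some .row)) := by
  obtain ⟨⟨f, c', zr, zt, zs, e, h1, h2, h3, h4⟩, -⟩ := h
  exact ⟨_, _, _, _, _, _, _, _, e, h1, h2, h3, h4, by simp⟩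

theorem feed_columns (f c r m : Bool) (zr zt zs : Zipper Letter) {n : Fin S.k → ℕ}
    {ι : Type*} (l : List ι) (g : ι → TField S n) :
    certainty.feed (⟨.columns, f, c, r, m⟩, bufs zr zt zs) (l.flatMap fun i => fieldWord (g i)) =
      (⟨.columns, f, c, r, m⟩, bufs zr zt zs) := by
  refine certainty.feed_eq_self _ fun x hx => ?_
  obtain ⟨i, -, hx⟩ := List.mem_flatMap.1 hx
  simp only [fieldWord, natWord, bitsWord, List.cons_append, List.append_assoc, List.mem_cons,
    List.mem_append, List.mem_map] at hx
  rcases hx with rfl | ⟨b, -, rfl⟩ | rfl | ⟨b, -, rfl⟩ | rfl | ⟨b, -, rfl⟩ <;>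
    simp [Streamer.next, certainty, Control.focus, Control.trans, bufs, Op.apply]

/-- With no row read yet the universal statement is vacuous, so an empty component counts as
containing the tuple. -/
theorem rowReady_columns (f r m : Bool) {zr zt : Zipper Letter} (zs : Zipper Letter)
    (h1 : zr.word = natWord q) (h2 : zt.word = tw) (h3 : f = true ↔ b) :
    RowReady q tw b True (⟨.columns, f, true, r, m⟩, bufs zr zt zs) := by
  refine ⟨⟨f, true, zr, zt, zs, ?_, h1, h2, h3, by simp⟩,
    ⟨true, r, m, zr, zt, zs, ?_, h1, h2, by simp⟩, ?_⟩ <;>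
  simp [Streamer.next, certainty, Control.focus, Control.trans, bufs, Op.apply]

theorem fieldsWord_flatMap {n : Fin S.k → ℕ} (g : TField S n → Val D X) {ι : Type*} (l : List ι)
    (k : ι → List (TField S n)) :
    fieldsWord encD encX (l.flatMap k) g = l.flatMap fun i => fieldsWord encD encX (k i) g := by
  simp [fieldsWord, List.flatMap_assoc]

namespace GWSD

variable (W : GWSD S D X) (j : Fin W.m)

/-- A local world as a function on all fields. -/
def extend (w : {f : TField S W.n // W.comp f = j} → Val D X) (f : TField S W.n) : Val D X :=
  if h : W.comp f = j then w ⟨f, h⟩ else .bot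

/-- This trades the dependent type of columns for a filtered list of plain fields; the default `⊥`
of `extend` is never written. -/
theorem flatMap_columns (w : {f : TField S W.n // W.comp f = j} → Val D X) :
    ((W.columns j).flatMap fun f => fieldWord f.1 ++ valWord encD encX (w f)) =
      fieldsWord encD encX ((allFields S W.n).filter fun f => W.comp f = j) (W.extend j w) := by
  unfold columns
  generalize allFields S W.n = l
  induction l with
  | nil => rfl
  | cons f l ih =>
    by_cases h : W.comp f = j
    · rw [List.filterMap_cons_some (dif_pos h), List.flatMap_cons, ih,
        List.filter_cons_of_pos (by simpa using h)]
      simp [fieldsWord, extend, h]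
    · rw [List.filterMap_cons_none (dif_neg h), ih, List.filter_cons_of_neg (by simpa using h)]

/-- The fields of the tuple `r.d`. -/
def tupleFields (S : Schema) (n : Fin S.k → ℕ) (r : Fin S.k) (d : Fin (n r)) :
    List (TField S n) :=
  (List.finRange (S.ar r)).map fun a => ⟨r, d, a⟩

/-- Tuple-levelness makes the block of an identifier present in full or absent, which is what
permits comparison in one pass. -/
theorem filter_tupleFields (hW : W.TupleLevel) (r : Fin S.k) (d : Fin (W.n r)) :
    (tupleFields S W.n r d).filter (fun f => W.comp f = j) =
      if W.comp ⟨r, d, ⟨0, S.ar_pos r⟩⟩ = j then tupleFields S W.n r d else [] := by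
  split_ifs with h
  · refine List.filter_eq_self.2 fun f hf => ?_
    obtain ⟨a, -, rfl⟩ := List.mem_map.1 hf
    simpa [← h] using hW r d _ _
  · refine List.filter_eq_nil_iff.2 fun f hf => ?_
    obtain ⟨a, -, rfl⟩ := List.mem_map.1 hf
    simp only [decide_eq_true_eq]
    rwa [hW r d a ⟨0, S.ar_pos r⟩]

theorem tupleFields_eq_cons (n : Fin S.k → ℕ) (r : Fin S.k) (d : Fin (n r)) :
    ∃ i l, tupleFields S n r d = i :: l ∧ i.rel = r ∧ (i.attr : ℕ) = 0 ∧
      ∀ i ∈ l, i.rel = r ∧ (i.attr : ℕ) ≠ 0 := by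
  have : ∀ N (_ : 0 < N), ∃ (a : Fin N) (l : List (Fin N)), List.finRange N = a :: l ∧
      (a : ℕ) = 0 ∧ ∀ b ∈ l, (b : ℕ) ≠ 0 := by
    rintro (_ | N) hN
    · omega
    · exact ⟨0, _, List.finRange_succ, rfl, by simp⟩
  obtain ⟨a, l, e, h1, h2⟩ := this _ (S.ar_pos r)
  refine ⟨⟨r, d, a⟩, l.map fun a => ⟨r, d, a⟩, by simp [tupleFields, e], rfl, h1, ?_⟩
  intro i hi
  obtain ⟨b, hb, rfl⟩ := List.mem_map.1 hi
  exact ⟨rfl, h2 b hb⟩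

variable {encD encX}

theorem rowContains_iff (hD : Function.Injective encD) (hX : Function.Injective encX)
    (hW : W.TupleLevel) (t : Fin (S.ar q) → D)
    (ht : ((List.finRange (S.ar q)).flatMap fun a => Letter.const :: bitsWord (encD (t a))) =
      .const :: tw) (w : {f : TField S W.n // W.comp f = j} → Val D X) :
    W.RowContains j w q t ↔ ∃ d, ((tupleFields S W.n q d).filter fun f => W.comp f = j).flatMap
      (fun i => valWord encD encX (W.extend j w i)) = .const :: tw := by
  refine exists_congr fun d => ?_
  rw [W.filter_tupleFields j hW, ← ht]
  split_ifs with h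
  · have h' : ∀ a, W.comp ⟨q, d, a⟩ = j := fun a => (hW q d a _).trans h
    have e := flatMap_valWord_inj hD hX (l := List.finRange (S.ar q))
      (g := fun a => W.extend j w ⟨q, d, a⟩) (g' := fun a => .sym (.const (t a)))
    rw [tupleFields, List.flatMap_map]
    refine Iff.trans ?_ e.symm
    simp [extend, h']
  -- An absent block contributes the empty word, which is not `.const :: tw`.
  · rw [ht]
    refine iff_of_false (fun hd => ?_) (by simp)
    exact h (hd _).1

theorem _root_.WorldSet.RowState.feed_row (h : RowState q tw b c p s)
    (hD : Function.Injective encD) (hX : Function.Injective encX)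
    (hW : W.TupleLevel) (t : Fin (S.ar q) → D)
    (ht : ((List.finRange (S.ar q)).flatMap fun a => Letter.const :: bitsWord (encD (t a))) =
      .const :: tw) (w : {f : TField S W.n // W.comp f = j} → Val D X) :
    RowState q tw b c (p ∨ W.RowContains j w q t) (certainty.feed s
      ((W.columns j).flatMap fun f => fieldWord f.1 ++ valWord encD encX (w f))) := by
  -- The shape of the nested enumeration in `allFields`, so that `feed_flatMap_or` applies once per
  -- level.
  have e : (W.RowContains j w q t) = ∃ r ∈ List.finRange S.k, ∃ d ∈ List.finRange (W.n r),
      r = q ∧ ((tupleFields S W.n r d).filter fun f => W.comp f = j).flatMap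
        (fun i => valWord encD encX (W.extend j w i)) = .const :: tw := by
    rw [W.rowContains_iff j hD hX hW t ht, eq_iff_iff]
    constructor
    · rintro ⟨d, hd⟩
      exact ⟨q, List.mem_finRange _, d, List.mem_finRange _, rfl, hd⟩
    · rintro ⟨r, -, d, -, rfl, hd⟩
      exact ⟨d, hd⟩
  rw [e, W.flatMap_columns, allFields, List.filter_flatMap, fieldsWord_flatMap]
  refine certainty.feed_flatMap_or (RowState q tw b c) _ _ _ (fun r _ p s h => ?_) h
  rw [List.filter_flatMap, fieldsWord_flatMap]
  refine certainty.feed_flatMap_or (RowState q tw b c) _ _ _ (fun d _ p s h => ?_) h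
  change RowState q tw b c _ (certainty.feed s (fieldsWord encD encX
    ((tupleFields S W.n r d).filter fun f => W.comp f = j) (W.extend j w)))
  obtain ⟨i, l, hil, hi, hi', hl⟩ := tupleFields_eq_cons W.n r d
  rw [W.filter_tupleFields j hW]
  split_ifs
  · by_cases hr : r = q
    · subst hr
      rw [hil]
      simpa using h.feed_active encD encX (W.extend j w) i l hi hi' hl
    · have := h.feed_inactive encD encX (W.extend j w) (tupleFields S W.n r d) fun i hi => by
        obtain ⟨a, -, rfl⟩ := List.mem_map.1 hi
        exact hr
      simpa [hr] using this
  · simpa [fieldsWord, Streamer.feed_nil] using h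

theorem _root_.WorldSet.CompReady.feed_componentWord (h : CompReady q tw b s)
    (hD : Function.Injective encD) (hX : Function.Injective encX)
    (hW : W.TupleLevel) (t : Fin (S.ar q) → D)
    (ht : ((List.finRange (S.ar q)).flatMap fun a => Letter.const :: bitsWord (encD (t a))) =
      .const :: tw) :
    CompReady q tw (b ∨ ∀ w ∈ W.rows j, W.RowContains j w q t)
      (certainty.feed s (componentWord encD encX W j)) := by
  obtain ⟨⟨f, r, m, zr, zt, zs, e, h1, h2, h3⟩, -⟩ := h
  rw [componentWord, List.cons_append, Streamer.feed_cons, Streamer.feed_append, e, feed_columns]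
  have := certainty.feed_flatMap_and (RowReady q tw b)
    (fun w => Letter.row :: (W.columns j).flatMap fun f => fieldWord f.1 ++ valWord encD encX (w f))
    (fun w => W.RowContains j w q t) (W.rows j)
    (fun w _ c s h => by
      rw [Streamer.feed_cons]
      simpa using (h.rowState_next.feed_row W j hD hX hW t ht w).rowReady)
    (rowReady_columns f r m zs h1 h2 h3)
  simpa using this.2

end GWSD

end Components

/-! ### Reading the global condition. -/

section Conditions

variable {D : Type u} {X : Type v} {encD : D → List Bool} {encX : X → List Bool}
variable {S : Schema} {q : Fin S.k} {tw : List Letter} {b : Prop}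
  {s : Control × (Buf → Zipper Letter)}

/-- The marks of the two sides are compared in the control, giving `e`; only the bits of the first
side go through the buffer. -/
theorem feed_neq (f c r m : Bool) (zr zt : Zipper Letter) (s₁ s₂ : Symb D X) :
    ∃ e v w, certainty.feed (⟨.neq, f, c, r, m⟩, bufs zr zt ([], []))
        (symbWord encD encX s₁ ++ symbWord encD encX s₂) =
      (⟨.sym₂ (e && decide (v <+: w)), f, c, r, m⟩, bufs zr zt (zipAt w v.length)) ∧
      (e = true ∧ v = w ↔ symbWord encD encX s₂ = symbWord encD encX s₁) := by
  refine ⟨decide (valMark (.sym s₂) = valMark (.sym s₁)),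
    bitsWord (valBits encD encX (.sym s₂)), bitsWord (valBits encD encX (.sym s₁)), ?_, ?_⟩
  · have h1 : certainty.next (⟨.neq, f, c, r, m⟩, bufs zr zt ([], [])) (some (valMark (.sym s₁))) =
        (⟨.sym₁ (decide (valMark (.sym s₁) = .var)), f, c, r, m⟩, bufs zr zt ([], [])) := by
      cases s₁ <;>
        simp [Streamer.next, certainty, Control.focus, Control.trans, bufs, Op.apply, valMark]
    have h2 (z : Zipper Letter) (hz : z.word = bitsWord (valBits encD encX (.sym s₁))) :
        certainty.next (⟨.sym₁ (decide (valMark (.sym s₁) = .var)), f, c, r, m⟩, bufs zr zt z)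
          (some (valMark (.sym s₂))) =
        (⟨.sym₂ (decide (valMark (.sym s₂) = valMark (.sym s₁)) &&
            decide ([] <+: bitsWord (valBits encD encX (.sym s₁)))), f, c, r, m⟩,
          bufs zr zt (zipAt (bitsWord (valBits encD encX (.sym s₁))) ([] : List Letter).length)) := by
      cases s₁ <;> cases s₂ <;>
        simp [Streamer.next, certainty, Control.focus, Control.trans, bufs, valMark, rewind_apply,
          hz]
    change certainty.feed _ (valWord encD encX (.sym s₁) ++ valWord encD encX (.sym s₂)) = _
    rw [valWord_eq, valWord_eq, List.cons_append, Streamer.feed_cons, Streamer.feed_append,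
      Streamer.feed_cons, h1, feed_sym₁, h2 _ (by simp [Zipper.word]), feed_sym₂]
    rfl
  · change _ ↔ valWord encD encX (.sym s₂) = valWord encD encX (.sym s₁)
    rw [valWord_eq, valWord_eq, List.cons.injEq, decide_eq_true_eq]

theorem CondReady.feed_neq (h : CondReady q tw b s) (hD : Function.Injective encD)
    (hX : Function.Injective encX) (p : Symb D X × Symb D X) :
    CondReady q tw (b ∨ p.1 = p.2) (certainty.feed s
      (Letter.neq :: symbWord encD encX p.1 ++ symbWord encD encX p.2)) := by
  obtain ⟨⟨f, zr, zt, e, h1, h2, h3⟩, -⟩ := h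
  rw [List.cons_append, Streamer.feed_cons, e]
  obtain ⟨e, v, w, h, hw⟩ := WorldSet.feed_neq (encD := encD) (encX := encX) f false false false
    zr zt p.1 p.2
  have hf : (f || (e && decide (v <+: w) && (zipAt w v.length).2.head?.isNone)) = true ↔
      b ∨ p.1 = p.2 := by
    rw [Bool.and_assoc, prefix_and_isNone, Bool.or_eq_true, Bool.and_eq_true, decide_eq_true_eq,
      hw, (symbWord_injective hD hX).eq_iff, h3, eq_comm (a := p.2)]
  rw [h]
  refine ⟨⟨_, zr, zt, ?_, h1, h2, hf⟩, ⟨_, false, false, zr, zt, zipAt w v.length, ?_, h1, h2, hf⟩, ?_⟩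
  · simp [Streamer.next, certainty, Control.focus, Control.trans, bufs, Op.apply]
  · simp [Streamer.next, certainty, Control.focus, Control.trans, bufs, Op.apply]
  · rw [← hf]
    simp [Streamer.next, certainty, Control.focus, Control.trans, bufs]

theorem condReady_queryTup {zr zt : Zipper Letter} (h1 : zr.word = natWord q)
    (h2 : zt.word = tw) :
    CondReady q tw False (⟨.queryTup, false, false, false, false⟩, bufs zr zt ([], [])) := by
  refine ⟨⟨false, zr, zt, ?_, h1, h2, by simp⟩,
    ⟨false, false, false, zr, zt, ([], []), ?_, h1, h2, by simp⟩, ?_⟩ <;>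
  simp [Streamer.next, certainty, Control.focus, Control.trans, bufs, Op.apply]

end Conditions

/-! ### Correctness on whole instances. -/

section Instances

variable {D X : Type} {encD : D → List Bool} {encX : X → List Bool}

theorem feed_schemaWord (S : Schema) (B : Buf → Zipper Letter) :
    certainty.feed (⟨.schema, false, false, false, false⟩, B) (schemaWord S) =
      (⟨.schema, false, false, false, false⟩, B) := by
  refine certainty.feed_eq_self _ fun x hx => ?_
  obtain ⟨i, -, hx⟩ := List.mem_flatMap.1 hx
  simp only [natWord, bitsWord, List.mem_cons, List.mem_map] at hx
  rcases hx with rfl | ⟨b, -, rfl⟩ <;>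
    simp [Streamer.next, certainty, Control.focus, Control.trans, Op.apply]

theorem feed_queryWord {S : Schema} (q : Fin S.k) (t : Fin (S.ar q) → D) (tw : List Letter)
    (ht : ((List.finRange (S.ar q)).flatMap fun a => Letter.const :: bitsWord (encD (t a))) =
      .const :: tw) :
    CondReady q tw False (certainty.feed
      (⟨.schema, false, false, false, false⟩, bufs ([], []) ([], []) ([], []))
      (queryWord encD q t)) := by
  have h1 : certainty.next (⟨.schema, false, false, false, false⟩,
      bufs ([], []) ([], []) ([], [])) (some .query) =
      (⟨.queryRel, false, false, false, false⟩, bufs ([], []) ([], []) ([], [])) := by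
    simp [Streamer.next, certainty, Control.focus, Control.trans, bufs, Op.apply]
  have h2 (z : Zipper Letter) : certainty.next (⟨.queryRel, false, false, false, false⟩,
      bufs z ([], []) ([], [])) (some .const) =
      (⟨.queryTup, false, false, false, false⟩, bufs z ([], []) ([], [])) := by
    simp [Streamer.next, certainty, Control.focus, Control.trans, bufs, Op.apply]
  have htw : ∀ x ∈ tw, x ≠ .neq ∧ x ≠ .component := by
    intro x hx
    have hx : x ∈ Letter.const :: tw := by simp [hx]
    rw [← ht] at hx
    obtain ⟨a, -, hx⟩ := List.mem_flatMap.1 hx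
    simp only [bitsWord, List.mem_cons, List.mem_map] at hx
    rcases hx with rfl | ⟨b, -, rfl⟩ <;> simp
  rw [queryWord, ht, List.cons_append, Streamer.feed_cons, Streamer.feed_append,
    Streamer.feed_cons, h1, natWord, feed_queryRel, h2, feed_queryTup _ _ _ _ _ _ _ _ htw]
  exact condReady_queryTup (by simp [Zipper.word, natWord]) (by simp [Zipper.word])

theorem verdict_instanceWord (hD : Function.Injective encD) (hX : Function.Injective encX)
    (I : CertInstance D X) :
    certainty.verdict (instanceWord encD encX I) = true ↔
      (∃ p ∈ I.wsd.cond, p.1 = p.2) ∨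
        ∃ j : Fin I.wsd.m, ∀ w ∈ I.wsd.rows j, I.wsd.RowContains j w I.rel I.tup := by
  obtain ⟨tw, ht⟩ : ∃ tw, ((List.finRange (I.schema.ar I.rel)).flatMap fun a =>
      Letter.const :: bitsWord (encD (I.tup a))) = .const :: tw := by
    -- A relation has at least one attribute, so the query word has a first `.const` to split off.
    have hpos := I.schema.ar_pos I.rel
    rcases h : List.finRange (I.schema.ar I.rel) with _ | ⟨a, l⟩
    · rw [List.finRange_eq_nil_iff] at h
      omega
    · exact ⟨_, rfl⟩
  have hB : (fun _ => ([], []) : Buf → Zipper Letter) = bufs ([], []) ([], []) ([], []) := by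
    funext i; cases i <;> rfl
  have h0 := feed_queryWord I.rel I.tup tw ht
  have h1 := certainty.feed_flatMap_or (CondReady I.rel tw)
    (fun p => Letter.neq :: symbWord encD encX p.1 ++ symbWord encD encX p.2)
    (fun p => p.1 = p.2) I.wsd.cond (fun p _ b s h => h.feed_neq hD hX p) h0
  have h2 := certainty.feed_flatMap_or (CompReady I.rel tw)
    (fun j => componentWord encD encX I.wsd j)
    (fun j => ∀ w ∈ I.wsd.rows j, I.wsd.RowContains j w I.rel I.tup) (List.finRange I.wsd.m)
    (fun j _ b s h => h.feed_componentWord I.wsd j hD hX I.tupleLevel I.tup ht) h1.2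
  rw [Streamer.verdict, hB, instanceWord, Streamer.feed_append, Streamer.feed_append,
    Streamer.feed_append]
  change (certainty.next (certainty.feed (certainty.feed (certainty.feed (certainty.feed
    (⟨.schema, false, false, false, false⟩, bufs ([], []) ([], []) ([], [])) _) _) _) _)
    none).1.found = true ↔ _
  rw [feed_schemaWord]
  refine h2.2.trans ?_
  simp

end Instances

end WorldSet

theorem mainTheorem4 :
    (∀ (D : Type) (X : Type) [Infinite D] (encD : D → List Bool) (encX : X → List Bool),
      Function.Injective encD → Function.Injective encX →
        WorldSet.DecidableInPolyTime (WorldSet.instanceWord encD encX)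
          (fun I : WorldSet.CertInstance D X => I.Certain)) ∧
    (∀ (D : Type*) (X : Type*) [Infinite D] (S : WorldSet.Schema) (W : WorldSet.GWSD S D X),
      W.TupleLevel → ∀ (r : Fin S.k) (t : Fin (S.ar r) → D),
        (W.Certain r t ↔
          (¬ W.cond.Satisfiable ∨ ∃ j : Fin W.m, ∀ w ∈ W.rows j, W.RowContains j w r t))) := by
  refine ⟨fun D X _ encD encX hD hX => ?_, fun D X _ S W hW r t => W.certain_iff hW r t⟩
  refine WorldSet.certainty.decidableInPolyTime _ _ fun I => ?_
  rw [WorldSet.verdict_instanceWord hD hX, WorldSet.CertInstance.Certain,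
    I.wsd.certain_iff I.tupleLevel, WorldSet.Condition.satisfiable_iff]
  push Not
  rfl
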